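/- Let $n\in\mathbb N$, $s\in\mathbb R$, $0<p<\infty$, $0<q\le\infty$ and $-n<\varrho<0$. Let $\varphi_0\in\mathcal S(\mathbb R^n)$ satisfy $\varphi_0(x)=1$ for $|x|\le 1$ and $\varphi_0(x)=0$ for $|x|\ge 3/2$, put $\varphi_k(x)=\varphi_0(2^{-k}x)-\varphi_0(2^{-k+1}x)$ for $k\ge 1$, and for $f\in\mathcal S'(\mathbb R^n)$ let $f_j=(\varphi_j\widehat f)^\vee$, $j\ge 0$, which are smooth functions. Let $Q_{J,M}=2^{-J}M+2^{-J}(0,1)^n$ for $J\in\mathbb Z$, $M\in\mathbb Z^n$, let $J^+=\max(J,0)$, and let $$\|g\,|\,\Lambda^\varrho_p\|=\sup_{J\in\mathbb Z,\,M\in\mathbb Z^n}2^{\frac Jp(n+\varrho)}\,\|g\,|\,L_p(Q_{J,M})\|.$$ Let $\Lambda_\varrho B^s_{p,q}(\mathbb R^n)$, $\Lambda_\varrho F^s_{p,q}(\mathbb R^n)$, $\Lambda^\varrho B^s_{p,q}(\mathbb R^n)$, $\Lambda^\varrho F^s_{p,q}(\mathbb R^n)$ be the spaces of all $f\in\mathcal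 S'(\mathbb R^n)$ for which, respectively, the quasi-norm $$\|f\,|\,\Lambda_\varrho B^s_{p,q}\|=\Big(\sum_{j\ge0}2^{jsq}\|f_j\,|\,\Lambda^\varrho_p\|^q\Big)^{1/q},$$ $$\|f\,|\,\Lambda_\varrho F^s_{p,q}\|=\Big\|\Big(\sum_{j\ge0}2^{jsq}|f_j(\cdot)|^q\Big)^{1/q}\Big|\,\Lambda^\varrho_p\Big\|,$$ $$\|f\,|\,\Lambda^\varrho B^s_{p,q}\|=\sup_{J\in\mathbb Z,\,M\in\mathbb Z^n}2^{\frac Jp(n+\varrho)}\Big(\sum_{j\ge J^+}2^{jsq}\|f_j\,|\,L_p(Q_{J,M})\|^q\Big)^{1/q},$$ $$\|f\,|\,\Lambda^\varrho F^s_{p,q}\|=\sup_{J\in\mathbb Z,\,M\in\mathbb Z^n}2^{\frac Jp(n+\varrho)}\Big\|\Big(\sum_{j\ge J^+}2^{jsq}|f_j(\cdot)|^q\Big)^{1/q}\Big|\,L_p(Q_{J,M})\Big\|$$ is finite (with suprema over $j$ in place of the sums if $q=\infty$). Let $\hookrightarrow$ denote continuous embedding, where $L_\infty(\mathbb R^n)$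 and the space $C(\mathbb R^n)$ of bounded continuous complex-valued functions with the supremum norm are regarded as subspaces of $\mathcal S'(\mathbb R^n)$. Then: 1. $\Lambda^\varrho B^s_{p,q}(\mathbb R^n)\hookrightarrow L_\infty(\mathbb R^n)$ if and only if $s>|\varrho|/p$, and $\Lambda^\varrho F^s_{p,q}(\mathbb R^n)\hookrightarrow L_\infty(\mathbb R^n)$ if and only if $s>|\varrho|/p$. 2. $\Lambda_\varrho B^s_{p,q}(\mathbb R^n)\hookrightarrow L_\infty(\mathbb R^n)$ if and only if either $s>|\varrho|/p$, or $s=|\varrho|/p$ and $q\le 1$. 3. $\Lambda_\varrho F^s_{p,q}(\mathbb R^n)\hookrightarrow L_\infty(\mathbb R^n)$ if and only if $s>|\varrho|/p$. 4. All four equivalences remain true with $C(\mathbb R^n)$ in place of $L_\infty(\mathbb R^n)$. -/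

import Mathlib

open MeasureTheory FourierTransform SchwartzMap BoundedContinuousFunction
open scoped ENNReal NNReal

noncomputable section

namespace MorreySmoothness

/-- Euclidean space of dimension `n`. -/
abbrev Euc (n : ℕ) : Type := EuclideanSpace ℝ (Fin n)

/-- The dilation `x ↦ c • x` of Euclidean space by a non-zero real number `c`. -/
def dilation {n : ℕ} (c : ℝ) (hc : c ≠ 0) : Euc n ≃L[ℝ] Euc n :=
  ContinuousLinearEquiv.smulLeft (Units.mk0 c hc)

theorem dilation_apply {n : ℕ} (c : ℝ) (hc : c ≠ 0) (x : Euc n) : dilation c hc x = c • x := rfl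

/-- The Schwartz function `x ↦ ψ (c • x)`. -/
def dilate {n : ℕ} (c : ℝ) (hc : c ≠ 0) (ψ : 𝓢(Euc n, ℂ)) : 𝓢(Euc n, ℂ) :=
  SchwartzMap.compCLMOfContinuousLinearEquiv ℂ (dilation c hc) ψ

theorem dilate_apply {n : ℕ} (c : ℝ) (hc : c ≠ 0) (ψ : 𝓢(Euc n, ℂ)) (x : Euc n) :
    dilate c hc ψ x = ψ (c • x) := rfl

/-- The generator `φ₀` of a dyadic resolution of unity: a Schwartz function which equals `1` on the
closed unit ball and `0` outside the open ball of radius `3 / 2`. -/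
structure Generator (n : ℕ) where
  toSchwartz : 𝓢(Euc n, ℂ)
  eq_one : ∀ x : Euc n, ‖x‖ ≤ 1 → toSchwartz x = 1
  eq_zero : ∀ x : Euc n, 3 / 2 ≤ ‖x‖ → toSchwartz x = 0

/-- The dyadic resolution of unity generated by `φ₀`, that is, `φ_0 = φ₀` and
`φ_k (x) = φ₀ (2 ^ (-k) x) - φ₀ (2 ^ (-k + 1) x)` for `k ≥ 1`. -/
def Generator.phi {n : ℕ} (φ : Generator n) : ℕ → 𝓢(Euc n, ℂ)
  | 0 => φ.toSchwartz
  | k + 1 => dilate ((2 : ℝ) ^ (-((k : ℤ) + 1))) (by positivity) φ.toSchwartz -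
      dilate ((2 : ℝ) ^ (-((k : ℤ) + 1) + 1)) (by positivity) φ.toSchwartz

theorem Generator.phi_zero_apply {n : ℕ} (φ : Generator n) (x : Euc n) :
    φ.phi 0 x = φ.toSchwartz x := rfl

theorem Generator.phi_succ_apply {n : ℕ} (φ : Generator n) (k : ℕ) (x : Euc n) :
    φ.phi (k + 1) x = φ.toSchwartz ((2 : ℝ) ^ (-((k : ℤ) + 1)) • x) -
      φ.toSchwartz ((2 : ℝ) ^ (-((k : ℤ) + 1) + 1) • x) := rfl

/-- The plane wave `ξ ↦ exp (2 π i ⟨x, ξ⟩)`. -/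
def wave {n : ℕ} (x ξ : Euc n) : ℂ :=
  Complex.exp (2 * Real.pi * Complex.I * ((inner ℝ x ξ : ℝ) : ℂ))

theorem wave_hasTemperateGrowth {n : ℕ} (x : Euc n) : (wave x).HasTemperateGrowth := by
  have key : Function.HasTemperateGrowth
      (fun t : ℝ => Complex.exp (2 * Real.pi * Complex.I * (t : ℂ))) := by
    set c : ℂ := 2 * Real.pi * Complex.I with hc
    have hd : ∀ k : ℕ, iteratedDeriv k (fun t : ℝ => Complex.exp (c * (t : ℂ))) =
        fun t : ℝ => c ^ k * Complex.exp (c * (t : ℂ)) := by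
      intro k
      induction k with
      | zero => simp
      | succ k ih =>
        rw [iteratedDeriv_succ, ih]
        funext t
        have h1 : HasDerivAt (fun t : ℝ => c * (t : ℂ)) c t := by
          simpa using (Complex.ofRealCLM.hasDerivAt (x := t)).const_mul c
        rw [(h1.cexp.const_mul (c ^ k)).deriv]
        ring
    refine ⟨(contDiff_const.mul Complex.ofRealCLM.contDiff).cexp, fun k => ⟨0, ‖c‖ ^ k, fun t => ?_⟩⟩
    rw [norm_iteratedFDeriv_eq_norm_iteratedDeriv, hd, norm_mul, norm_pow, Complex.norm_exp]
    simp [hc]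
  exact key.comp (Function.hasTemperateGrowth_inner_right x)

/-- The Schwartz function `ξ ↦ exp (2 π i ⟨x, ξ⟩) φ_j (2 π ξ)`. -/
def Generator.testFun {n : ℕ} (φ : Generator n) (j : ℕ) (x : Euc n) : 𝓢(Euc n, ℂ) :=
  SchwartzMap.smulLeftCLM ℂ (wave x) (dilate (2 * Real.pi) (by positivity) (φ.phi j))

theorem Generator.testFun_apply {n : ℕ} (φ : Generator n) (j : ℕ) (x ξ : Euc n) :
    φ.testFun j x ξ = wave x ξ * φ.phi j ((2 * Real.pi) • ξ) := by
  rw [Generator.testFun, SchwartzMap.smulLeftCLM_apply_apply (wave_hasTemperateGrowth x)]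
  rfl

/-- The pointwise value at `x` of the entire analytic function `(φ_j f̂)^∨`, where `f` is a tempered
distribution and the Fourier transform is normalised as
`f̂ (ξ) = (2 π) ^ (- n / 2) ∫ exp (- i x ξ) f x dx`.
The inverse Fourier transform of the compactly supported distribution `φ_j f̂` takes at `x` the value
`(2 π) ^ (- n / 2)` times the pairing of `f̂` with `ξ ↦ exp (i x ξ) φ_j ξ`. Mathlib's transform `𝓕`
has the kernel `exp (- 2 π i x ξ)` and `f̂` arises from `𝓕 f` by a dilation by `2 π`; substituting
`ξ ↦ 2 π ξ`, the value becomes the pairing of `𝓕 f` with `ξ ↦ exp (2 π i x ξ) φ_j (2 π ξ)`. -/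
def Generator.piece {n : ℕ} (φ : Generator n) (f : 𝓢'(Euc n, ℂ)) (j : ℕ) (x : Euc n) : ℂ :=
  (𝓕 f) (φ.testFun j x)

/-- The open dyadic cube `2 ^ (-J) M + 2 ^ (-J) (0, 1) ^ n`. -/
def dyadicCube {n : ℕ} (J : ℤ) (M : Fin n → ℤ) : Set (Euc n) :=
  {x | ∀ i, (2 : ℝ) ^ (-J) * M i < x i ∧ x i < (2 : ℝ) ^ (-J) * M i + (2 : ℝ) ^ (-J)}

/-- The quasi-norm `(∫_Q h ^ p dx) ^ (1 / p)` of a non-negative function `h` in `L_p (Q)`. -/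
def lpOn {n : ℕ} (p : ℝ) (Q : Set (Euc n)) (h : Euc n → ℝ≥0∞) : ℝ≥0∞ :=
  (∫⁻ x in Q, h x ^ p) ^ (1 / p)

/-- The quasi-norm `(∑_j a_j ^ q) ^ (1 / q)` in `ℓ_q`, which is `sup_j a_j` for `q = ∞`. -/
def lqSeq (q : ℝ≥0∞) (a : ℕ → ℝ≥0∞) : ℝ≥0∞ :=
  if q = ∞ then ⨆ j, a j else (∑' j, a j ^ q.toReal) ^ (1 / q.toReal)

/-- The Morrey weight `2 ^ (J (n + ϱ) / p)`. -/
def weight (n : ℕ) (ϱ p : ℝ) (J : ℤ) : ℝ≥0∞ :=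
  ENNReal.ofReal ((2 : ℝ) ^ ((J : ℝ) / p * ((n : ℝ) + ϱ)))

/-- The Morrey quasi-norm of (the absolute value `h` of) a function in `Λ^ϱ_p`. -/
def morreyNorm {n : ℕ} (ϱ p : ℝ) (h : Euc n → ℝ≥0∞) : ℝ≥0∞ :=
  ⨆ (J : ℤ) (M : Fin n → ℤ), weight n ϱ p J * lpOn p (dyadicCube J M) h

/-- The function `2 ^ (j s) |(φ_j f̂)^∨|`. -/
def Generator.scaled {n : ℕ} (φ : Generator n) (s : ℝ) (f : 𝓢'(Euc n, ℂ)) (j : ℕ) (x : Euc n) :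
    ℝ≥0∞ :=
  ENNReal.ofReal ((2 : ℝ) ^ ((j : ℝ) * s)) * ‖φ.piece f j x‖ₑ

/-- The quasi-norm of `Λ_ϱ B^s_{p,q}`. The space consists of all tempered distributions for which it
is finite, and likewise for the following three quasi-norms. -/
def lowerB {n : ℕ} (φ : Generator n) (ϱ s p : ℝ) (q : ℝ≥0∞) (f : 𝓢'(Euc n, ℂ)) : ℝ≥0∞ :=
  lqSeq q fun j => morreyNorm ϱ p (φ.scaled s f j)

/-- The quasi-norm of `Λ_ϱ F^s_{p,q}`. -/
def lowerF {n : ℕ} (φ : Generator n) (ϱ s p : ℝ) (q : ℝ≥0∞) (f : 𝓢'(Euc n, ℂ)) : ℝ≥0∞ :=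
  morreyNorm ϱ p fun x => lqSeq q fun j => φ.scaled s f j x

/-- The quasi-norm of `Λ^ϱ B^s_{p,q}`; the sums run over `j ≥ J⁺ = max (J, 0)`. -/
def upperB {n : ℕ} (φ : Generator n) (ϱ s p : ℝ) (q : ℝ≥0∞) (f : 𝓢'(Euc n, ℂ)) : ℝ≥0∞ :=
  ⨆ (J : ℤ) (M : Fin n → ℤ), weight n ϱ p J *
    lqSeq q fun j => if J.toNat ≤ j then lpOn p (dyadicCube J M) (φ.scaled s f j) else 0

/-- The quasi-norm of `Λ^ϱ F^s_{p,q}`; the sums run over `j ≥ J⁺ = max (J, 0)`. -/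
def upperF {n : ℕ} (φ : Generator n) (ϱ s p : ℝ) (q : ℝ≥0∞) (f : 𝓢'(Euc n, ℂ)) : ℝ≥0∞ :=
  ⨆ (J : ℤ) (M : Fin n → ℤ), weight n ϱ p J *
    lpOn p (dyadicCube J M) fun x => lqSeq q fun j =>
      if J.toNat ≤ j then φ.scaled s f j x else 0

/-- The tempered distribution `f` is the regular distribution given by the function `g`. -/
def IsRegular {n : ℕ} (f : 𝓢'(Euc n, ℂ)) (g : Euc n → ℂ) : Prop :=
  ∀ ψ : 𝓢(Euc n, ℂ), f ψ = ∫ x, ψ x * g x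

/-- Continuous embedding into `L_∞`, as subspaces of the tempered distributions, of the space of all
`f` whose quasi-norm `N f` is finite. -/
def EmbedsLinfty {n : ℕ} (N : 𝓢'(Euc n, ℂ) → ℝ≥0∞) : Prop :=
  ∃ C : ℝ≥0, ∀ f, N f < ∞ →
    ∃ g : Lp ℂ ∞ (volume : Measure (Euc n)), IsRegular f g ∧ ‖g‖ₑ ≤ C * N f

/-- Continuous embedding into the space of bounded continuous functions with the supremum norm, as
subspaces of the tempered distributions, of the space of all `f` whose quasi-norm `N f` is
finite. -/
def EmbedsC {n : ℕ} (N : 𝓢'(Euc n, ℂ) → ℝ≥0∞) : Prop :=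
  ∃ C : ℝ≥0, ∀ f, N f < ∞ → ∃ g : Euc n →ᵇ ℂ, IsRegular f g ∧ ‖g‖ₑ ≤ C * N f

end MorreySmoothness

end

/-!
Write `r = |ϱ| / p`.

*Sufficiency.* Every tempered distribution is the sum of its band-limited pieces `f_j`
(`Generator.tendsto_sum_integral_piece`), so that `f` is given by a bounded continuous function of
norm at most `∑_j sup |f_j|` whenever this sum is finite (`embedsC_of_tsum_le`). The frequencies of
`f_j` are of order at most `2 ^ j`, and the Nikol'skii inequality bounds `sup |f_j|` by the `L_p`
means of `f_j` over the dyadic cubes of side length `2 ^ (-j)`. In terms of the Morrey weight it is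
`sup |f_j| ≤ C 2 ^ (j r) ‖f_j‖`, where only the cubes of that one side length enter the Morrey norm
(`Generator.enorm_piece_le_levelNorm`). All four quasi-norms control `2 ^ (j s)` times this
quantity for each `j`, hence `sup |f_j| ≤ C 2 ^ (j (r - s)) ‖f‖`, which is summable for `s > r`. If
`s = r` and `q ≤ 1`, summability is what the `ℓ_q` norm outside the Morrey norm provides
(`embedsC_lowerB_of_le_one`). The embeddings into `C` imply those into `L_∞`, so that the necessary
conditions only have to be derived for `L_∞`.

The Nikol'skii inequality for `p ≤ 1` rests on the reproducing formula of `f_j`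
(`bandPart_reproducing`) and on a maximal function which has to be known to be finite, that is, on
the polynomial growth of `f_j`. Both facts follow from a representation of a tempered distribution
as a bounded functional of finitely many weighted derivatives of the test function
(`exists_eq_comp_jet`, a consequence of the Hahn-Banach theorem): the functional commutes with
Bochner integrals in the Banach space of these derivatives.

*Necessity.* Let `θ` be a non-negative bump whose support lies in an annulus on which only one
function of the resolution of unity is non-zero, and equal to `1`. With `ψ = 𝓕⁻ θ`, the sum
`∑_{1 ≤ j ≤ N} c_j ψ (2 ^ (j - 1) x)` has exactly the summands as its frequency pieces, and at the
origin its value is `(∑ c_j) ψ 0`, where `ψ 0 = ∫ θ > 0`. For `c_j = 2 ^ (j (r - s))` the rapid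
decay of `ψ` shows that the `ℓ_q` norm of the pieces `2 ^ (j s) f_j` at `x` is at most
`C |x| ^ (-r)` (`Generator.exists_lqSeq_scaled_lacunarySum_le`), a function in the Morrey space, because
`r p < n`. This bounds both `F` quasi-norms uniformly in `N`. In `Λ^ϱ B^s_{p,q}` the sum over `j` is
taken on each cube separately, from its own scale on, where the pieces decay geometrically
(`exists_upperB_lacunarySum_le`), so that this quasi-norm is bounded as well. The value at the
origin is unbounded if `s ≤ r`. In the fourth space `Λ_ϱ B^s_{p,q}` the pieces have comparable
norms: a single summand excludes `s < r`, and `N` summands of norm about one have quasi-norm about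
`N ^ (1 / q)` and value about `N` at the origin, which excludes `s = r` and `q > 1`.
-/

noncomputable section

namespace MorreySmoothness

open Filter Topology LineDeriv

/-! ### Evaluating a tempered distribution at translates of a test function -/

section Translation

variable {V : Type*} [NormedAddCommGroup V] [InnerProductSpace ℝ V]

theorem iteratedFDeriv_translate (η : 𝓢(V, ℂ)) (y x : V) (l : ℕ) :
    iteratedFDeriv ℝ l (compSubConstCLM ℂ y η) x = iteratedFDeriv ℝ l η (x - y) := by
  have : (compSubConstCLM ℂ y η : V → ℂ) = fun z => η (z - y) := by
    ext z; rfl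
  rw [this, iteratedFDeriv_comp_sub]

theorem seminorm_translate_le (η : 𝓢(V, ℂ)) (k l : ℕ) :
    ∃ C : ℝ, 0 ≤ C ∧ ∀ y : V,
      SchwartzMap.seminorm ℂ k l (compSubConstCLM ℂ y η) ≤ C * (1 + ‖y‖) ^ k := by
  refine ⟨2 ^ k * ((Finset.Iic (k, l)).sup fun m => SchwartzMap.seminorm ℂ m.1 m.2) η,
    by positivity, fun y => ?_⟩
  refine SchwartzMap.seminorm_le_bound ℂ k l _ (by positivity) fun x => ?_
  rw [iteratedFDeriv_translate]
  have h := SchwartzMap.one_add_le_sup_seminorm_apply (𝕜 := ℂ) (m := (k, l)) le_rfl le_rfl η (x - y)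
  have hx : ‖x‖ ≤ (1 + ‖x - y‖) * (1 + ‖y‖) := by
    have h1 : ‖x‖ ≤ ‖x - y‖ + ‖y‖ := by simpa using norm_add_le (x - y) y
    nlinarith [norm_nonneg (x - y), norm_nonneg y]
  calc ‖x‖ ^ k * ‖iteratedFDeriv ℝ l η (x - y)‖
      ≤ ((1 + ‖x - y‖) * (1 + ‖y‖)) ^ k * ‖iteratedFDeriv ℝ l η (x - y)‖ := by gcongr
    _ = ((1 + ‖x - y‖) ^ k * ‖iteratedFDeriv ℝ l η (x - y)‖) * (1 + ‖y‖) ^ k := by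
        rw [mul_pow]; ring
    _ ≤ _ := by gcongr

/-- Translations act continuously on a Schwartz function: by the mean value inequality the
seminorms of `η (· - h) - η` are `O (‖h‖)`. -/
theorem continuous_translate (η : 𝓢(V, ℂ)) :
    Continuous fun y : V => compSubConstCLM ℂ y η := by
  rw [continuous_iff_continuousAt]
  intro y₀
  rw [ContinuousAt, (schwartz_withSeminorms ℂ V ℂ).tendsto_nhds _ _]
  rintro ⟨k, l⟩ ε hε
  set θ := compSubConstCLM ℂ y₀ η with hθ
  set C := 2 ^ k * ((Finset.Iic (k, l + 1)).sup fun m => SchwartzMap.seminorm ℂ m.1 m.2) θ with hC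
  have hC0 : 0 ≤ C := by positivity
  have key : ∀ h : V, ‖h‖ ≤ 1 →
      SchwartzMap.seminorm ℂ k l (compSubConstCLM ℂ h θ - θ) ≤ C * ‖h‖ := by
    intro h hh
    refine SchwartzMap.seminorm_le_bound ℂ k l _ (by positivity) fun x => ?_
    have hsub : iteratedFDeriv ℝ l (compSubConstCLM ℂ h θ - θ : 𝓢(V, ℂ)) x =
        iteratedFDeriv ℝ l θ (x - h) - iteratedFDeriv ℝ l θ x := by
      rw [← iteratedFDeriv_translate]
      exact iteratedFDeriv_sub_apply ((compSubConstCLM ℂ h θ).contDiffAt l) (θ.contDiffAt l)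
    rw [hsub]
    have hd : Differentiable ℝ (iteratedFDeriv ℝ l θ) :=
      (θ.smooth ⊤).differentiable_iteratedFDeriv (mod_cast ENat.natCast_lt_top l)
    have hmv := Convex.norm_image_sub_le_of_norm_fderiv_le (𝕜 := ℝ) (s := segment ℝ x (x - h))
      (f := fun z => (‖x‖ ^ k) • iteratedFDeriv ℝ l θ z) (C := C)
      (fun z _ => (hd z).fun_const_smul _) (fun z hz => ?_) (convex_segment _ _)
      (left_mem_segment ℝ x (x - h)) (right_mem_segment ℝ x (x - h))
    · rw [← smul_sub, norm_smul] at hmv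
      simpa using hmv
    · rw [fderiv_fun_const_smul (hd z), norm_smul, norm_fderiv_iteratedFDeriv]
      have h1 := SchwartzMap.one_add_le_sup_seminorm_apply (𝕜 := ℂ) (m := (k, l + 1)) le_rfl le_rfl
          θ z
      have h2 : ‖x‖ ≤ 1 + ‖z‖ := by
        have h3 : ‖z - x‖ ≤ ‖x - h - x‖ := by
          obtain ⟨a, b, ha, hb, hab, rfl⟩ := hz
          have : a • x + b • (x - h) - x = b • (x - h - x) := by
            rw [show a = 1 - b by linarith]; module
          rw [this, norm_smul, Real.norm_of_nonneg hb]
          exact mul_le_of_le_one_left (norm_nonneg _) (by linarith)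
        have h4 : ‖x - h - x‖ = ‖h‖ := by simp
        have h5 : ‖x‖ ≤ ‖z‖ + ‖z - x‖ := by
          simpa using norm_sub_le z (z - x)
        linarith
      refine le_trans ?_ h1
      rw [Real.norm_of_nonneg (by positivity)]
      gcongr
  have hev : ∀ᶠ y in 𝓝 y₀, ‖y - y₀‖ < min 1 (ε / (C + 1)) := by
    have : Tendsto (fun y => ‖y - y₀‖) (𝓝 y₀) (𝓝 0) := by
      have : Continuous fun y : V => ‖y - y₀‖ := by fun_prop
      simpa using this.tendsto y₀
    exact this.eventually_lt_const (by positivity)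
  filter_upwards [hev] with y hy
  have h1 : compSubConstCLM ℂ y η = compSubConstCLM ℂ (y - y₀) θ := by
    rw [hθ, compSubConstCLM_comp]; congr 2; abel
  rw [h1]
  refine (key (y - y₀) (hy.le.trans (min_le_left _ _))).trans_lt ?_
  have h2 := hy.trans_le (min_le_right _ _)
  rw [lt_div_iff₀ (by positivity)] at h2
  nlinarith [norm_nonneg (y - y₀)]

end Translation

section Jet

variable {V : Type*} [NormedAddCommGroup V] [InnerProductSpace ℝ V]

/-- The weighted derivative `x ↦ ‖x‖ ^ k • D ^ l θ x` of a Schwartz function `θ`, as a bounded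
continuous function. Its supremum norm is the Schwartz seminorm of index `(k, l)`. -/
def weightedDeriv (k l : ℕ) (θ : 𝓢(V, ℂ)) : V →ᵇ (V [×l]→L[ℝ] ℂ) :=
  BoundedContinuousFunction.ofNormedAddCommGroup (fun x => (‖x‖ ^ k : ℝ) • iteratedFDeriv ℝ l θ x)
    (by
      have := (θ.smooth ⊤).continuous_iteratedFDeriv (m := l) (mod_cast le_top)
      fun_prop)
    (SchwartzMap.seminorm ℂ k l θ) (fun x => by
      rw [norm_smul, Real.norm_of_nonneg (by positivity)]
      exact SchwartzMap.le_seminorm ℂ k l θ x)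

theorem weightedDeriv_apply (k l : ℕ) (θ : 𝓢(V, ℂ)) (x : V) :
    weightedDeriv k l θ x = (‖x‖ ^ k : ℝ) • iteratedFDeriv ℝ l θ x := rfl

theorem norm_weightedDeriv (k l : ℕ) (θ : 𝓢(V, ℂ)) :
    ‖weightedDeriv k l θ‖ = SchwartzMap.seminorm ℂ k l θ := by
  refine le_antisymm (BoundedContinuousFunction.norm_ofNormedAddCommGroup_le _
    (apply_nonneg _ _) _) ?_
  refine SchwartzMap.seminorm_le_bound ℂ k l _ (norm_nonneg (weightedDeriv k l θ)) fun x => ?_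
  have := (weightedDeriv k l θ).norm_coe_le_norm x
  rwa [weightedDeriv_apply, norm_smul, Real.norm_of_nonneg (by positivity)] at this

theorem weightedDeriv_add (k l : ℕ) (θ η : 𝓢(V, ℂ)) :
    weightedDeriv k l (θ + η) = weightedDeriv k l θ + weightedDeriv k l η := by
  ext1 x
  have h : iteratedFDeriv ℝ l (θ + η : 𝓢(V, ℂ)) x =
      iteratedFDeriv ℝ l θ x + iteratedFDeriv ℝ l η x :=
    iteratedFDeriv_add_apply (θ.contDiffAt l) (η.contDiffAt l)
  rw [BoundedContinuousFunction.add_apply, weightedDeriv_apply, weightedDeriv_apply,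
    weightedDeriv_apply, h, smul_add]

theorem weightedDeriv_smul (k l : ℕ) (a : ℂ) (θ : 𝓢(V, ℂ)) :
    weightedDeriv k l (a • θ) = a • weightedDeriv k l θ := by
  ext1 x
  have h : iteratedFDeriv ℝ l (a • θ : 𝓢(V, ℂ)) x = a • iteratedFDeriv ℝ l θ x :=
    iteratedFDeriv_const_smul_apply (θ.contDiffAt l)
  rw [BoundedContinuousFunction.smul_apply, weightedDeriv_apply, weightedDeriv_apply, h, smul_comm]

variable (V) in
/-- The Banach space of families of bounded continuous functions, of the kind of the `l`-th
derivatives, indexed by the pairs `(k, l)` in `s`. -/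
def JetSpace (s : Finset (ℕ × ℕ)) : Type _ :=
  ∀ i : s, V →ᵇ (V [×i.1.2]→L[ℝ] ℂ)

instance (s : Finset (ℕ × ℕ)) : NormedAddCommGroup (JetSpace V s) :=
  inferInstanceAs (NormedAddCommGroup (∀ i : s, V →ᵇ (V [×i.1.2]→L[ℝ] ℂ)))

instance (s : Finset (ℕ × ℕ)) : NormedSpace ℂ (JetSpace V s) :=
  inferInstanceAs (NormedSpace ℂ (∀ i : s, V →ᵇ (V [×i.1.2]→L[ℝ] ℂ)))

instance (s : Finset (ℕ × ℕ)) : CompleteSpace (JetSpace V s) :=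
  inferInstanceAs (CompleteSpace (∀ i : s, V →ᵇ (V [×i.1.2]→L[ℝ] ℂ)))

/-- The value at `x` of the component of index `i` of a family in `JetSpace V s`. -/
def JetSpace.eval (s : Finset (ℕ × ℕ)) (i : s) (x : V) :
    JetSpace V s →L[ℂ] (V [×i.1.2]→L[ℝ] ℂ) :=
  (BoundedContinuousFunction.evalCLM ℂ x).comp
    (ContinuousLinearMap.proj (R := ℂ) (φ := fun i : s => V →ᵇ (V [×i.1.2]→L[ℝ] ℂ)) i)

theorem JetSpace.ext {s : Finset (ℕ × ℕ)} {u v : JetSpace V s}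
    (h : ∀ i x, JetSpace.eval s i x u = JetSpace.eval s i x v) : u = v := by
  funext i
  ext1 x
  exact h i x

/-- The finitely many weighted derivatives indexed by `s`, as a continuous linear map into a Banach
space. -/
def jet (s : Finset (ℕ × ℕ)) : 𝓢(V, ℂ) →L[ℂ] JetSpace V s :=
  SchwartzMap.mkCLMtoNormedSpace (σ := RingHom.id ℂ) (G := JetSpace V s)
    (fun θ (i : s) => weightedDeriv i.1.1 i.1.2 θ)
    (fun f g => funext fun i => weightedDeriv_add _ _ f g)
    (fun a f => funext fun i => weightedDeriv_smul _ _ a f)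
    ⟨s, 1, zero_le_one, fun f => by
      rw [one_mul]
      refine (pi_norm_le_iff_of_nonneg
        (G := fun i : s => V →ᵇ (V [×i.1.2]→L[ℝ] ℂ)) (apply_nonneg _ f)).2 fun i => ?_
      rw [norm_weightedDeriv]
      exact Seminorm.le_def.1 (Finset.le_sup (f := schwartzSeminormFamily ℂ V ℂ) i.2) f⟩

theorem eval_jet (s : Finset (ℕ × ℕ)) (i : s) (x : V) (θ : 𝓢(V, ℂ)) :
    JetSpace.eval s i x (jet s θ) = (‖x‖ ^ i.1.1 : ℝ) • iteratedFDeriv ℝ i.1.2 θ x := rfl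

theorem seminorm_le_norm_jet (s : Finset (ℕ × ℕ)) (θ : 𝓢(V, ℂ)) (i : s) :
    SchwartzMap.seminorm ℂ i.1.1 i.1.2 θ ≤ ‖jet s θ‖ := by
  rw [← norm_weightedDeriv]
  exact norm_le_pi_norm (G := fun i : s => V →ᵇ (V [×i.1.2]→L[ℝ] ℂ)) (jet s θ) i

theorem norm_jet_le (s : Finset (ℕ × ℕ)) (θ : 𝓢(V, ℂ)) :
    ‖jet s θ‖ ≤ ∑ i ∈ s, SchwartzMap.seminorm ℂ i.1 i.2 θ := by
  refine (pi_norm_le_iff_of_nonneg (G := fun i : s => V →ᵇ (V [×i.1.2]→L[ℝ] ℂ))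
    (Finset.sum_nonneg fun i _ => apply_nonneg _ θ)).2 fun i => ?_
  refine (norm_weightedDeriv i.1.1 i.1.2 θ).le.trans ?_
  exact Finset.single_le_sum (f := fun i : ℕ × ℕ => SchwartzMap.seminorm ℂ i.1 i.2 θ)
    (fun i _ => apply_nonneg _ θ) i.2

theorem sup_seminorm_le_norm_jet (s : Finset (ℕ × ℕ)) (θ : 𝓢(V, ℂ)) :
    s.sup (schwartzSeminormFamily ℂ V ℂ) θ ≤ ‖jet s θ‖ := by
  refine Seminorm.finset_sup_apply_le (norm_nonneg _) fun i hi => ?_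
  exact seminorm_le_norm_jet s θ ⟨i, hi⟩

/-- Every tempered distribution factors through finitely many weighted derivatives followed by a
bounded functional on a Banach space, by the Hahn-Banach theorem. -/
theorem exists_eq_comp_jet (f : 𝓢'(V, ℂ)) :
    ∃ (s : Finset (ℕ × ℕ)) (Φ : JetSpace V s →L[ℂ] ℂ),
      ∀ θ : 𝓢(V, ℂ), f θ = Φ (jet s θ) := by
  have hf : Continuous (fun θ : 𝓢(V, ℂ) => f θ) := map_continuous f
  obtain ⟨s, C, -, hC⟩ := Seminorm.bound_of_continuous (schwartz_withSeminorms ℂ V ℂ)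
    ((normSeminorm ℂ ℂ).comp (f : 𝓢(V, ℂ) →ₗ[ℂ] ℂ)) (continuous_norm.comp hf)
  refine ⟨s, ?_⟩
  have hb : ∀ θ : 𝓢(V, ℂ), ‖f θ‖ ≤ C * ‖jet s θ‖ := fun θ =>
    (Seminorm.le_def.1 hC θ).trans
      (mul_le_mul_of_nonneg_left (sup_seminorm_le_norm_jet s θ) C.2)
  set T : 𝓢(V, ℂ) →ₗ[ℂ] JetSpace V s := (jet s).toLinearMap with hT
  -- by `hb` the value `f θ` depends on `jet s θ` only, so a linear section `σ` of `jet s` serves to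
  -- define the functional
  obtain ⟨σ, hσ⟩ := T.rangeRestrict.exists_rightInverse_of_surjective T.range_rangeRestrict
  have hσ' : ∀ y, jet s (σ y) = y := fun y =>
    congrArg Subtype.val (LinearMap.congr_fun hσ y)
  let Φ₀ : StrongDual ℂ (LinearMap.range T) :=
    LinearMap.mkContinuous ((f : 𝓢(V, ℂ) →ₗ[ℂ] ℂ) ∘ₗ σ) C fun y => by
      have := hb (σ y)
      rw [hσ' y] at this
      exact this
  obtain ⟨Φ, hΦ, -⟩ := exists_extension_norm_eq _ Φ₀
  refine ⟨Φ, fun θ => ?_⟩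
  have h1 := hΦ ⟨jet s θ, ⟨θ, rfl⟩⟩
  have h2 : f (σ ⟨jet s θ, ⟨θ, rfl⟩⟩) = f θ := by
    have h3 := hb (σ ⟨jet s θ, ⟨θ, rfl⟩⟩ - θ)
    rw [map_sub (jet s), hσ', sub_self, norm_zero, mul_zero] at h3
    have h4 := norm_le_zero_iff.1 h3
    rw [map_sub] at h4
    exact sub_eq_zero.1 h4
  exact h2.symm.trans h1.symm

theorem exists_norm_jet_translate_le (s : Finset (ℕ × ℕ)) (η : 𝓢(V, ℂ)) :
    ∃ (C : ℝ) (k : ℕ), 0 ≤ C ∧ ∀ y : V, ‖jet s (compSubConstCLM ℂ y η)‖ ≤ C * (1 + ‖y‖) ^ k := by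
  choose C hC0 hC using fun i : ℕ × ℕ => seminorm_translate_le η i.1 i.2
  refine ⟨∑ i ∈ s, C i, s.sup Prod.fst, Finset.sum_nonneg fun i _ => hC0 i, fun y => ?_⟩
  refine (norm_jet_le s _).trans ?_
  rw [Finset.sum_mul]
  refine Finset.sum_le_sum fun i hi => (hC i y).trans ?_
  refine mul_le_mul_of_nonneg_left ?_ (hC0 i)
  exact pow_le_pow_right₀ (by linarith [norm_nonneg y]) (Finset.le_sup (f := Prod.fst) hi)

end Jet

section Convolution

variable {V : Type*} [NormedAddCommGroup V] [InnerProductSpace ℝ V] [FiniteDimensional ℝ V]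
  [MeasurableSpace V] [BorelSpace V]

theorem integrable_one_add_norm_pow_mul (ψ : 𝓢(V, ℂ)) (k : ℕ) :
    Integrable fun y => (1 + ‖y‖) ^ k * ‖ψ y‖ := by
  have h : ∀ y : V, (1 + ‖y‖) ^ k * ‖ψ y‖ =
      ∑ j ∈ Finset.range (k + 1), (k.choose j : ℝ) * (‖y‖ ^ j * ‖ψ y‖) := by
    intro y
    rw [add_comm, add_pow, Finset.sum_mul]
    refine Finset.sum_congr rfl fun j _ => ?_
    rw [one_pow]; ring
  simp_rw [h]
  exact integrable_finsetSum _ fun j _ => (ψ.integrable_pow_mul volume j).const_mul _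

theorem integrable_jet_translate (s : Finset (ℕ × ℕ)) (η ψ : 𝓢(V, ℂ)) :
    Integrable fun y => ψ y • jet s (compSubConstCLM ℂ y η) := by
  have hcont : Continuous fun y => jet s (compSubConstCLM ℂ y η) :=
    (jet s).continuous.comp (continuous_translate η)
  obtain ⟨C, k, hC0, hC⟩ := exists_norm_jet_translate_le s η
  refine ((integrable_one_add_norm_pow_mul ψ k).const_mul C).mono'
    (ψ.continuous.smul hcont).aestronglyMeasurable (.of_forall fun y => ?_)
  rw [norm_smul]
  nlinarith [hC y, norm_nonneg (ψ y)]

theorem convolution_mul_apply (ψ η : 𝓢(V, ℂ)) (x : V) :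
    SchwartzMap.convolution (ContinuousLinearMap.mul ℂ ℂ) ψ η x = ∫ y, ψ y * η (x - y) := by
  rw [SchwartzMap.convolution_apply]; rfl

/-- Differentiation can be passed to the second factor of a convolution, as seen on the Fourier
side. -/
theorem lineDerivOp_convolution (v : V) (ψ η : 𝓢(V, ℂ)) :
    ∂_{v} (SchwartzMap.convolution (ContinuousLinearMap.mul ℂ ℂ) ψ η) =
      SchwartzMap.convolution (ContinuousLinearMap.mul ℂ ℂ) ψ (∂_{v} η) := by
  have hv : (inner ℝ · v : V → ℝ).HasTemperateGrowth := by fun_prop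
  apply (FourierTransform.fourierCLE ℂ 𝓢(V, ℂ)).injective
  simp only [FourierTransform.fourierCLE_apply]
  rw [SchwartzMap.fourier_convolution, fourier_lineDerivOp_eq, SchwartzMap.fourier_convolution,
    fourier_lineDerivOp_eq]
  ext x
  simp [hv, SchwartzMap.smulLeftCLM_apply_apply]
  ring

theorem iteratedLineDerivOp_convolution {l : ℕ} (m : Fin l → V) (ψ η : 𝓢(V, ℂ)) :
    ∂^{m} (SchwartzMap.convolution (ContinuousLinearMap.mul ℂ ℂ) ψ η) =
      SchwartzMap.convolution (ContinuousLinearMap.mul ℂ ℂ) ψ (∂^{m} η) := by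
  induction l with
  | zero => simp
  | succ l ih =>
    rw [iteratedLineDerivOp_succ_left, iteratedLineDerivOp_succ_left, ih]
    exact lineDerivOp_convolution _ _ _

/-- Evaluating a tempered distribution at the translates of `η` and integrating against `ψ` amounts
to evaluating it at the convolution of `ψ` and `η`. -/
theorem integral_translate (f : 𝓢'(V, ℂ)) (η ψ : 𝓢(V, ℂ)) :
    ∫ y, ψ y * f (compSubConstCLM ℂ y η) =
      f (SchwartzMap.convolution (ContinuousLinearMap.mul ℂ ℂ) ψ η) := by
  obtain ⟨s, Φ, hΦ⟩ := exists_eq_comp_jet f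
  have hint := integrable_jet_translate s η ψ
  have h1 : ∫ y, ψ y • jet s (compSubConstCLM ℂ y η) =
      jet s (SchwartzMap.convolution (ContinuousLinearMap.mul ℂ ℂ) ψ η) := by
    refine JetSpace.ext fun i x => ?_
    have hint' := (JetSpace.eval s i x).integrable_comp hint
    rw [← (JetSpace.eval s i x).integral_comp_comm hint, eval_jet]
    ext m
    rw [_root_.smul_apply, ← iteratedLineDerivOp_eq_iteratedFDeriv,
      iteratedLineDerivOp_convolution, convolution_mul_apply, ← integral_smul]
    refine (((ContinuousMultilinearMap.apply ℝ (fun _ : Fin i.1.2 => V) ℂ m).integral_comp_comm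
      hint').symm).trans (integral_congr_ae (.of_forall fun y => ?_))
    simp only [map_smul, eval_jet, iteratedFDeriv_translate]
    rw [iteratedLineDerivOp_eq_iteratedFDeriv]
    simp only [ContinuousMultilinearMap.apply_apply, _root_.smul_apply]
    rw [smul_comm, smul_eq_mul (a := ψ y)]
  rw [hΦ, ← h1, ← Φ.integral_comp_comm hint]
  refine integral_congr_ae (.of_forall fun y => ?_)
  simp only [map_smul, hΦ, smul_eq_mul]

end Convolution

/-! ### Band-limited parts of tempered distributions -/

variable {n : ℕ}

theorem fourier_wave_smul (x : Euc n) (χ : 𝓢(Euc n, ℂ)) :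
    𝓕 (SchwartzMap.smulLeftCLM ℂ (wave x) χ) = compSubConstCLM ℂ x (𝓕 χ) := by
  ext z
  rw [compSubConstCLM_apply, fourier_coe, fourier_coe, Real.fourier_eq', Real.fourier_eq']
  refine integral_congr_ae (.of_forall fun ξ => ?_)
  simp only [SchwartzMap.smulLeftCLM_apply_apply (wave_hasTemperateGrowth x), smul_eq_mul, wave]
  rw [← mul_assoc, ← Complex.exp_add, inner_sub_right, real_inner_comm ξ x]
  congr 2
  push_cast
  ring

theorem smulLeftCLM_wave_smulLeftCLM (x : Euc n) (χ θ : 𝓢(Euc n, ℂ)) :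
    SchwartzMap.smulLeftCLM ℂ χ (SchwartzMap.smulLeftCLM ℂ (wave x) θ) =
      SchwartzMap.smulLeftCLM ℂ (wave x) (SchwartzMap.smulLeftCLM ℂ χ θ) := by
  ext ξ
  simp only [SchwartzMap.smulLeftCLM_apply_apply (wave_hasTemperateGrowth x),
    SchwartzMap.smulLeftCLM_apply_apply χ.hasTemperateGrowth, smul_eq_mul]
  ring

theorem convolution_fourier (ψ χ : 𝓢(Euc n, ℂ)) :
    SchwartzMap.convolution (ContinuousLinearMap.mul ℂ ℂ) ψ (𝓕 χ) =
      𝓕 (SchwartzMap.smulLeftCLM ℂ χ (𝓕⁻ ψ)) := by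
  apply (FourierTransform.fourierCLE ℂ 𝓢(Euc n, ℂ)).symm.injective
  simp only [FourierTransform.fourierCLE_symm_apply, FourierTransform.fourierInv_fourier_eq]
  have hneg : ∀ (g : 𝓢(Euc n, ℂ)) (x : Euc n), (𝓕⁻ g) x = 𝓕 g (-x) := fun g x => rfl
  ext x
  rw [hneg, SchwartzMap.fourier_convolution, SchwartzMap.pairing_apply_apply,
    SchwartzMap.smulLeftCLM_apply_apply χ.hasTemperateGrowth, ← hneg, ← hneg,
    FourierTransform.fourierInv_fourier_eq]
  simp [mul_comm]

/-- The value at `x` of the smooth function `𝓕⁻ (χ 𝓕 f)`, for a tempered distribution `f` and a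
Schwartz function `χ`. -/
def bandPart (f : 𝓢'(Euc n, ℂ)) (χ : 𝓢(Euc n, ℂ)) (x : Euc n) : ℂ :=
  (𝓕 f) (SchwartzMap.smulLeftCLM ℂ (wave x) χ)

theorem bandPart_eq (f : 𝓢'(Euc n, ℂ)) (χ : 𝓢(Euc n, ℂ)) (x : Euc n) :
    bandPart f χ x = f (compSubConstCLM ℂ x (𝓕 χ)) := by
  rw [bandPart, TemperedDistribution.fourier_apply, fourier_wave_smul]

theorem continuous_bandPart (f : 𝓢'(Euc n, ℂ)) (χ : 𝓢(Euc n, ℂ)) :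
    Continuous (bandPart f χ) := by
  have : bandPart f χ = fun x => f (compSubConstCLM ℂ x (𝓕 χ)) := funext (bandPart_eq f χ)
  rw [this]
  exact (map_continuous f).comp (continuous_translate _)

/-- Band-limited parts of tempered distributions grow at most polynomially. -/
theorem exists_norm_bandPart_le (f : 𝓢'(Euc n, ℂ)) (χ : 𝓢(Euc n, ℂ)) :
    ∃ (C : ℝ) (k : ℕ), 0 ≤ C ∧ ∀ x, ‖bandPart f χ x‖ ≤ C * (1 + ‖x‖) ^ k := by
  obtain ⟨s, Φ, hΦ⟩ := exists_eq_comp_jet f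
  obtain ⟨C, k, hC0, hC⟩ := exists_norm_jet_translate_le s (𝓕 χ)
  refine ⟨‖Φ‖ * C, k, by positivity, fun x => ?_⟩
  rw [bandPart_eq, hΦ, mul_assoc]
  exact (Φ.le_opNorm _).trans (mul_le_mul_of_nonneg_left (hC x) (norm_nonneg _))

/-- `𝓕⁻ (χ 𝓕 f)` is the regular distribution given by `bandPart f χ`. -/
theorem integral_mul_bandPart (f : 𝓢'(Euc n, ℂ)) (χ ψ : 𝓢(Euc n, ℂ)) :
    ∫ y, ψ y * bandPart f χ y = (𝓕 f) (SchwartzMap.smulLeftCLM ℂ χ (𝓕⁻ ψ)) := by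
  simp_rw [bandPart_eq]
  rw [integral_translate, convolution_fourier, TemperedDistribution.fourier_apply]

/-- A band-limited function is reproduced by convolution with any kernel whose Fourier transform is
`1` on the band. -/
theorem bandPart_reproducing (f : 𝓢'(Euc n, ℂ)) (χ χ' : 𝓢(Euc n, ℂ))
    (h : ∀ ξ, χ ξ * χ' ξ = χ ξ) (x : Euc n) :
    bandPart f χ x = ∫ y, (𝓕 χ') (y - x) * bandPart f χ y := by
  have h1 := integral_mul_bandPart f χ (compSubConstCLM ℂ x (𝓕 χ'))
  simp only [compSubConstCLM_apply] at h1
  rw [h1, ← fourier_wave_smul, FourierTransform.fourierInv_fourier_eq,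
    smulLeftCLM_wave_smulLeftCLM]
  have h2 : SchwartzMap.smulLeftCLM ℂ χ χ' = χ := by
    ext ξ
    rw [SchwartzMap.smulLeftCLM_apply_apply χ.hasTemperateGrowth, smul_eq_mul, h]
  rw [h2, bandPart]

theorem fourier_dilate (c : ℝ) (hc : 0 < c) (χ : 𝓢(Euc n, ℂ)) (z : Euc n) :
    𝓕 (dilate c hc.ne' χ) z = ((c ^ n)⁻¹ : ℝ) • 𝓕 χ (c⁻¹ • z) := by
  rw [fourier_coe, fourier_coe, Real.fourier_eq', Real.fourier_eq']
  have h := Measure.integral_comp_smul (volume : Measure (Euc n))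
    (fun v => Complex.exp ((-2 * Real.pi * inner ℝ v (c⁻¹ • z) : ℝ) * Complex.I) • χ v) c
  rw [finrank_euclideanSpace_fin, abs_of_pos (by positivity)] at h
  rw [← h]
  refine integral_congr_ae (.of_forall fun ξ => ?_)
  simp only [dilate_apply]
  rw [real_inner_smul_left, real_inner_smul_right, mul_inv_cancel_left₀ hc.ne']

/-- Cutting off by `φ₀ (c ·)`, where `φ₀` equals `1` on the unit ball, converges to the identity in
the Schwartz space as `c → 0`. -/
theorem tendsto_cutoff (φ : Generator n) (θ : 𝓢(Euc n, ℂ)) (c : ℕ → ℝ) (hc : ∀ k, 0 < c k)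
    (hc1 : ∀ k, c k ≤ 1) (hlim : Tendsto c atTop (𝓝 0)) :
    Tendsto (fun k => SchwartzMap.smulLeftCLM ℂ (dilate (c k) (hc k).ne' φ.toSchwartz) θ)
      atTop (𝓝 θ) := by
  rw [(schwartz_withSeminorms ℂ (Euc n) ℂ).tendsto_nhds _ _]
  rintro ⟨m, l⟩ ε hε
  set u : ℝ → Euc n → ℂ := fun a x => φ.toSchwartz (a • x) - 1 with hu
  set B : ℝ := ∑ i ∈ Finset.range (l + 1), (l.choose i : ℝ) *
    (SchwartzMap.seminorm ℂ 0 i φ.toSchwartz + 1) *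
      SchwartzMap.seminorm ℂ (m + 1) (l - i) θ with hB
  have hB0 : 0 ≤ B := Finset.sum_nonneg fun i _ => by positivity
  have hus : ∀ a, ContDiff ℝ (⊤ : ℕ∞) (u a) := fun a =>
    ((φ.toSchwartz.smooth ⊤).comp (contDiff_const_smul a)).sub contDiff_const
  have hud : ∀ a, 0 < a → a ≤ 1 → ∀ (i : ℕ) (x : Euc n), ‖iteratedFDeriv ℝ i (u a) x‖ ≤
      SchwartzMap.seminorm ℂ 0 i φ.toSchwartz + 1 := by
    intro a ha ha1 i x
    have h0 : iteratedFDeriv ℝ i (u a) x =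
        iteratedFDeriv ℝ i (fun x => φ.toSchwartz (a • x)) x -
          iteratedFDeriv ℝ i (fun _ : Euc n => (1 : ℂ)) x :=
      iteratedFDeriv_sub_apply
        (((φ.toSchwartz.smooth ⊤).comp (contDiff_const_smul a)).of_le
          (mod_cast le_top)).contDiffAt contDiffAt_const
    rw [h0]
    refine (norm_sub_le _ _).trans (add_le_add ?_ ?_)
    · rw [iteratedFDeriv_comp_const_smul a (φ.toSchwartz.smooth i)]
      rw [norm_smul, norm_pow, Real.norm_of_nonneg ha.le]
      exact (mul_le_of_le_one_left (norm_nonneg _) (pow_le_one₀ ha.le ha1)).trans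
        (SchwartzMap.norm_iteratedFDeriv_le_seminorm ℂ _ _ _)
    · rcases i with _ | i
      · simp
      · simp [iteratedFDeriv_succ_const]
  have key : ∀ k, SchwartzMap.seminorm ℂ m l
      (SchwartzMap.smulLeftCLM ℂ (dilate (c k) (hc k).ne' φ.toSchwartz) θ - θ) ≤ c k * B := by
    intro k
    refine SchwartzMap.seminorm_le_bound ℂ m l _ (mul_nonneg (hc k).le hB0) fun x => ?_
    have hfun : ((SchwartzMap.smulLeftCLM ℂ (dilate (c k) (hc k).ne' φ.toSchwartz) θ - θ :
        𝓢(Euc n, ℂ)) : Euc n → ℂ) = fun x => u (c k) x * θ x := by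
      funext x
      rw [_root_.sub_apply, SchwartzMap.smulLeftCLM_apply_apply
        (dilate (c k) (hc k).ne' φ.toSchwartz).hasTemperateGrowth, dilate_apply, smul_eq_mul, hu]
      ring
    rw [hfun]
    -- `u (c k)` vanishes for `‖x‖ < (c k)⁻¹`, elsewhere a factor `c k * ‖x‖ ≥ 1` can be inserted
    rcases lt_or_ge (‖x‖) (c k)⁻¹ with hx | hx
    · have h0 : (fun x => u (c k) x * θ x) =ᶠ[𝓝 x] fun _ => 0 := by
        filter_upwards [(isOpen_lt continuous_norm continuous_const).mem_nhds hx] with y hy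
        have : φ.toSchwartz (c k • y) = 1 := by
          apply φ.eq_one
          rw [norm_smul, Real.norm_of_nonneg (hc k).le]
          have := mul_le_mul_of_nonneg_left (le_of_lt hy) (hc k).le
          rwa [mul_inv_cancel₀ (hc k).ne'] at this
        simp [hu, this]
      rw [(h0.iteratedFDeriv ℝ l).eq_of_nhds]
      have : iteratedFDeriv ℝ l (fun _ : Euc n => (0 : ℂ)) x = 0 := by
        simp
      rw [this, norm_zero, mul_zero]
      exact mul_nonneg (hc k).le hB0
    · have h1 := norm_iteratedFDeriv_mul_le (N := (⊤ : ℕ∞)) (n := l) (hus (c k)) (θ.smooth ⊤) x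
        (mod_cast le_top)
      have h2 : 1 ≤ c k * ‖x‖ := by
        have := mul_le_mul_of_nonneg_left hx (hc k).le
        rwa [mul_inv_cancel₀ (hc k).ne'] at this
      calc ‖x‖ ^ m * ‖iteratedFDeriv ℝ l (fun x => u (c k) x * θ x) x‖
          ≤ (c k * ‖x‖) * (‖x‖ ^ m * ‖iteratedFDeriv ℝ l (fun x => u (c k) x * θ x) x‖) :=
            le_mul_of_one_le_left (by positivity) h2
        _ = c k * (‖x‖ ^ (m + 1) * ‖iteratedFDeriv ℝ l (fun x => u (c k) x * θ x) x‖) := by ring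
        _ ≤ c k * B := by
            refine mul_le_mul_of_nonneg_left ?_ (hc k).le
            refine (mul_le_mul_of_nonneg_left h1 (by positivity)).trans ?_
            rw [Finset.mul_sum, hB]
            refine Finset.sum_le_sum fun i _ => ?_
            have h3 := hud (c k) (hc k) (hc1 k) i x
            have h4 := SchwartzMap.le_seminorm ℂ (m + 1) (l - i) θ x
            calc ‖x‖ ^ (m + 1) * ((l.choose i : ℝ) * ‖iteratedFDeriv ℝ i (u (c k)) x‖ *
                  ‖iteratedFDeriv ℝ (l - i) θ x‖)
                = (l.choose i : ℝ) * ‖iteratedFDeriv ℝ i (u (c k)) x‖ *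
                  (‖x‖ ^ (m + 1) * ‖iteratedFDeriv ℝ (l - i) θ x‖) := by ring
              _ ≤ _ := by gcongr
  have hlim' : Tendsto (fun k => c k * B) atTop (𝓝 0) := by simpa using hlim.mul_const B
  filter_upwards [hlim'.eventually_lt_const hε] with k hk
  exact (key k).trans_lt hk

/-! ### The Littlewood-Paley decomposition -/

theorem Generator.piece_eq_bandPart (φ : Generator n) (f : 𝓢'(Euc n, ℂ)) (j : ℕ) :
    φ.piece f j = bandPart f (dilate (2 * Real.pi) (by positivity) (φ.phi j)) := rfl

theorem Generator.continuous_piece (φ : Generator n) (f : 𝓢'(Euc n, ℂ)) (j : ℕ) :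
    Continuous (φ.piece f j) :=
  continuous_bandPart _ _

theorem Generator.sum_phi (φ : Generator n) (k : ℕ) (x : Euc n) :
    ∑ j ∈ Finset.range (k + 1), φ.phi j x = φ.toSchwartz (((2 : ℝ) ^ k)⁻¹ • x) := by
  induction k with
  | zero => simp [Generator.phi_zero_apply]
  | succ k ih =>
    rw [Finset.sum_range_succ, ih, Generator.phi_succ_apply]
    have h1 : (2 : ℝ) ^ (-((k : ℤ) + 1) + 1) = ((2 : ℝ) ^ k)⁻¹ := by
      rw [neg_add, neg_add_cancel_right, zpow_neg, zpow_natCast]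
    have h2 : (2 : ℝ) ^ (-((k : ℤ) + 1)) = ((2 : ℝ) ^ (k + 1))⁻¹ := by
      rw [zpow_neg]; norm_cast
    rw [h1, h2]
    ring

/-- The Littlewood-Paley decomposition `f = ∑_j f_j` in the sense of tempered distributions. -/
theorem Generator.tendsto_sum_integral_piece (φ : Generator n) (f : 𝓢'(Euc n, ℂ))
    (ψ : 𝓢(Euc n, ℂ)) :
    Tendsto (fun N => ∑ j ∈ Finset.range N, ∫ y, ψ y * φ.piece f j y) atTop (𝓝 (f ψ)) := by
  -- the factor `2 π` is at most `2 ^ 3`, so that the dilation factors below are at most `1`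
  rw [← tendsto_add_atTop_iff_nat 4]
  set c : ℕ → ℝ := fun k => ((2 : ℝ) ^ (k + 3))⁻¹ * (2 * Real.pi) with hc
  have hc0 : ∀ k, 0 < c k := fun k => by positivity
  have hc1 : ∀ k, c k ≤ 1 := by
    intro k
    rw [hc]
    simp only
    rw [inv_mul_le_iff₀ (by positivity), mul_one, pow_add]
    have h1 : (1 : ℝ) ≤ 2 ^ k := one_le_pow₀ (by norm_num)
    have h2 := Real.pi_le_four
    nlinarith
  have hlim : Tendsto c atTop (𝓝 0) := by
    have h1 : Tendsto (fun k : ℕ => ((2 : ℝ) ^ (k + 3))⁻¹) atTop (𝓝 0) :=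
      (tendsto_pow_atTop_atTop_of_one_lt one_lt_two).inv_tendsto_atTop.comp
        (tendsto_add_atTop_nat 3)
    simpa using h1.mul_const (2 * Real.pi)
  have h := ((map_continuous (𝓕 f)).tendsto _).comp
    (tendsto_cutoff φ (𝓕⁻ ψ) c hc0 hc1 hlim)
  rw [TemperedDistribution.fourier_apply, FourierTransform.fourier_fourierInv_eq] at h
  refine h.congr fun k => ?_
  simp only [Function.comp_apply, φ.piece_eq_bandPart, integral_mul_bandPart]
  rw [← map_sum]
  congr 1
  ext x
  rw [SchwartzMap.smulLeftCLM_apply_apply (SchwartzMap.hasTemperateGrowth _), dilate_apply,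
    _root_.sum_apply]
  simp only [SchwartzMap.smulLeftCLM_apply_apply (SchwartzMap.hasTemperateGrowth _), dilate_apply]
  rw [← Finset.sum_smul, φ.sum_phi, smul_smul]

/-- The dilate `φ₀ (2 ^ (-(j + 1)) ·)` equals `1` on the support of `φ_j`. -/
theorem Generator.phi_mul_toSchwartz (φ : Generator n) (j : ℕ) (x : Euc n) :
    φ.phi j x * φ.toSchwartz (((2 : ℝ) ^ (j + 1))⁻¹ • x) = φ.phi j x := by
  have key : ∀ (k : ℕ), k ≤ j → φ.toSchwartz (((2 : ℝ) ^ k)⁻¹ • x) *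
      φ.toSchwartz (((2 : ℝ) ^ (j + 1))⁻¹ • x) = φ.toSchwartz (((2 : ℝ) ^ k)⁻¹ • x) := by
    intro k hk
    rcases lt_or_ge ‖((2 : ℝ) ^ k)⁻¹ • x‖ (3 / 2) with h | h
    · rw [φ.eq_one (((2 : ℝ) ^ (j + 1))⁻¹ • x), mul_one]
      rw [norm_smul, norm_inv, norm_pow, Real.norm_two, inv_mul_lt_iff₀ (by positivity)] at h
      rw [norm_smul, norm_inv, norm_pow, Real.norm_two, inv_mul_le_iff₀ (by positivity), mul_one]
      have h2 : (2 : ℝ) ^ k ≤ 2 ^ j := pow_le_pow_right₀ (by norm_num) hk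
      have h3 : (0 : ℝ) < 2 ^ j := by positivity
      rw [pow_succ]
      linarith
    · rw [φ.eq_zero _ h, zero_mul]
  rcases j with _ | j
  · simpa [Generator.phi_zero_apply] using key 0 le_rfl
  · have h1 : (2 : ℝ) ^ (-((j : ℤ) + 1) + 1) = ((2 : ℝ) ^ j)⁻¹ := by
      rw [neg_add, neg_add_cancel_right, zpow_neg, zpow_natCast]
    have h2 : (2 : ℝ) ^ (-((j : ℤ) + 1)) = ((2 : ℝ) ^ (j + 1))⁻¹ := by
      rw [zpow_neg]; norm_cast
    rw [Generator.phi_succ_apply, h1, h2, sub_mul, key _ le_rfl, key j (Nat.le_succ j)]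

theorem exists_norm_le_one_add_norm_pow (θ : 𝓢(Euc n, ℂ)) (m : ℕ) :
    ∃ D : ℝ≥0, ∀ z, ‖θ z‖ ≤ D * ((1 + ‖z‖) ^ m)⁻¹ := by
  refine ⟨⟨2 ^ m * ((Finset.Iic (m, 0)).sup fun m => SchwartzMap.seminorm ℂ m.1 m.2) θ,
    by positivity⟩, fun z => ?_⟩
  rw [le_mul_inv_iff₀ (by positivity), mul_comm]
  have := SchwartzMap.one_add_le_sup_seminorm_apply (𝕜 := ℂ) (m := (m, 0)) le_rfl le_rfl θ z
  rwa [norm_iteratedFDeriv_zero] at this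

/-- The kernel `lam ^ n (1 + lam |x - y|) ^ (-m)`, whose integral in `y` does not depend on
`lam` and `x`. -/
def decayKernel (lam : ℝ) (m : ℕ) (x y : Euc n) : ℝ≥0∞ :=
  ENNReal.ofReal (lam ^ n * ((1 + lam * ‖y - x‖) ^ m)⁻¹)

/-- The piece `f_j` is dominated by its mean against a kernel of width `2 ^ (-j)` which decays as
rapidly as desired. The constant does not depend on `f` and `j`. -/
theorem Generator.enorm_piece_le_lintegral (φ : Generator n) (m : ℕ) :
    ∃ D : ℝ≥0, ∀ (f : 𝓢'(Euc n, ℂ)) (j : ℕ) (x : Euc n),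
      ‖φ.piece f j x‖ₑ ≤ D * ∫⁻ y, decayKernel (2 ^ j) m x y * ‖φ.piece f j y‖ₑ := by
  obtain ⟨D, hD⟩ := exists_norm_le_one_add_norm_pow
    (𝓕 (dilate Real.pi Real.pi_ne_zero φ.toSchwartz)) m
  refine ⟨D, fun f j x => ?_⟩
  set c : ℝ := ((2 : ℝ) ^ j)⁻¹ with hc
  have hc0 : 0 < c := by positivity
  have h1 := bandPart_reproducing f (dilate (2 * Real.pi) (by positivity) (φ.phi j))
    (dilate c hc0.ne' (dilate Real.pi Real.pi_ne_zero φ.toSchwartz)) (fun ξ => by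
      simp only [dilate_apply]
      have := φ.phi_mul_toSchwartz j ((2 * Real.pi) • ξ)
      rw [smul_smul] at this ⊢
      convert this using 4
      rw [hc, pow_succ]
      field_simp) x
  rw [← φ.piece_eq_bandPart] at h1
  rw [h1, ← lintegral_const_mul' _ _ ENNReal.coe_ne_top]
  refine (enorm_integral_le_lintegral_enorm _).trans (lintegral_mono fun y => ?_)
  rw [enorm_mul, ← mul_assoc]
  gcongr
  rw [fourier_dilate c hc0, hc, inv_inv, decayKernel, ← ofReal_norm,
    ← ENNReal.ofReal_coe_nnreal, ← ENNReal.ofReal_mul (NNReal.coe_nonneg D)]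
  refine ENNReal.ofReal_le_ofReal ?_
  rw [norm_smul, inv_pow, inv_inv, Real.norm_of_nonneg (by positivity)]
  have h2 := hD ((2 : ℝ) ^ j • (y - x))
  rw [norm_smul, norm_pow, Real.norm_two] at h2
  calc ((2 : ℝ) ^ j) ^ n * ‖𝓕 (dilate Real.pi Real.pi_ne_zero φ.toSchwartz) ((2 : ℝ) ^ j • (y - x))‖
      ≤ ((2 : ℝ) ^ j) ^ n * (D * ((1 + 2 ^ j * ‖y - x‖) ^ m)⁻¹) := by gcongr
    _ = _ := by ring

/-! ### Dyadic cubes and the Nikol'skii inequality -/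

theorem dyadicCube_eq_preimage (J : ℤ) (M : Fin n → ℤ) :
    dyadicCube J M = (WithLp.ofLp : Euc n → Fin n → ℝ) ⁻¹' Set.univ.pi fun i =>
      Set.Ioo ((2 : ℝ) ^ (-J) * M i) ((2 : ℝ) ^ (-J) * M i + (2 : ℝ) ^ (-J)) := by
  ext x
  simp [dyadicCube]

theorem measurableSet_dyadicCube (J : ℤ) (M : Fin n → ℤ) : MeasurableSet (dyadicCube J M) := by
  rw [dyadicCube_eq_preimage]
  exact (PiLp.volume_preserving_ofLp (Fin n)).measurable
    (MeasurableSet.univ_pi fun i => measurableSet_Ioo)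

theorem volume_dyadicCube (J : ℤ) (M : Fin n → ℤ) :
    volume (dyadicCube J M) = ENNReal.ofReal (((2 : ℝ) ^ (-J)) ^ n) := by
  rw [dyadicCube_eq_preimage, (PiLp.volume_preserving_ofLp (Fin n)).measure_preimage
    (MeasurableSet.univ_pi fun i => measurableSet_Ioo).nullMeasurableSet, Real.volume_pi_Ioo]
  rw [ENNReal.ofReal_pow (by positivity)]
  simp

theorem disjoint_dyadicCube (J : ℤ) :
    Pairwise (Function.onFun Disjoint fun M : Fin n → ℤ => dyadicCube J M) := by
  intro M M' hne
  refine Set.disjoint_left.2 fun x hx hx' => hne (funext fun i => ?_)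
  have h2 : (0 : ℝ) < 2 ^ (-J) := by positivity
  have h3 := (hx i).1.trans (hx' i).2
  have h4 := (hx' i).1.trans (hx i).2
  have h5 : (M i : ℝ) < M' i + 1 := by
    by_contra! h; nlinarith
  have h6 : (M' i : ℝ) < M i + 1 := by
    by_contra! h; nlinarith
  norm_cast at h5 h6
  omega

theorem ae_mem_iUnion_dyadicCube (J : ℤ) :
    ∀ᵐ x : Euc n, x ∈ ⋃ M : Fin n → ℤ, dyadicCube J M := by
  have h1 : ∀ᵐ x : Euc n, ∀ (i : Fin n) (m : ℤ), x i ≠ (2 : ℝ) ^ (-J) * m := by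
    refine ae_all_iff.2 fun i => ae_all_iff.2 fun m => ?_
    exact (PiLp.volume_preserving_ofLp (Fin n)).quasiMeasurePreserving.ae
      (Measure.ae_eval_ne (μ := fun _ : Fin n => (volume : Measure ℝ)) i ((2 : ℝ) ^ (-J) * m))
  filter_upwards [h1] with x hx
  have h2 : (0 : ℝ) < 2 ^ (-J) := by positivity
  refine Set.mem_iUnion.2 ⟨fun i => ⌊x i / (2 : ℝ) ^ (-J)⌋, fun i => ⟨?_, ?_⟩⟩
  · refine lt_of_le_of_ne ?_ (hx i _).symm
    rw [mul_comm, ← le_div_iff₀ h2]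
    exact Int.floor_le _
  · have := Int.lt_floor_add_one (x i / (2 : ℝ) ^ (-J))
    rw [div_lt_iff₀ h2] at this
    linarith

theorem lintegral_eq_tsum_dyadicCube (J : ℤ) (h : Euc n → ℝ≥0∞) :
    ∫⁻ x, h x = ∑' M : Fin n → ℤ, ∫⁻ x in dyadicCube J M, h x := by
  rw [← lintegral_iUnion (measurableSet_dyadicCube J) (disjoint_dyadicCube J)]
  rw [Measure.restrict_eq_self_of_ae_mem (ae_mem_iUnion_dyadicCube J)]

theorem norm_sub_le_of_mem_dyadicCube {J : ℤ} {M : Fin n → ℤ} {x y : Euc n}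
    (hx : x ∈ dyadicCube J M) (hy : y ∈ dyadicCube J M) : ‖x - y‖ ≤ n * (2 : ℝ) ^ (-J) := by
  have h2 : (0 : ℝ) < 2 ^ (-J) := by positivity
  have h : ‖x - y‖ ≤ ∑ i, ‖(x - y) i‖ := by
    have h1 : x - y = ∑ i, (x - y) i • EuclideanSpace.basisFun (Fin n) ℝ i :=
      ((EuclideanSpace.basisFun (Fin n) ℝ).sum_repr (x - y)).symm
    conv_lhs => rw [h1]
    refine (norm_sum_le _ _).trans (Finset.sum_le_sum fun i _ => ?_)
    rw [norm_smul]; simp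
  refine h.trans ((Finset.sum_le_card_nsmul _ _ ((2 : ℝ) ^ (-J)) fun i _ => ?_).trans_eq (by simp))
  rw [PiLp.sub_apply, Real.norm_eq_abs, abs_le]
  constructor <;> linarith [(hx i).1, (hx i).2, (hy i).1, (hy i).2]

theorem lintegral_comp_smul (c : ℝ) (hc : 0 < c) (h : Euc n → ℝ≥0∞) :
    ∫⁻ x, h (c • x) = ENNReal.ofReal ((c ^ n)⁻¹) * ∫⁻ x, h x := by
  have h1 := lintegral_map_equiv (μ := (volume : Measure (Euc n))) h
    (MeasurableEquiv.smul₀ c hc.ne')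
  have h2 : Measure.map (MeasurableEquiv.smul₀ c hc.ne') (volume : Measure (Euc n)) =
      ENNReal.ofReal ((c ^ n)⁻¹) • volume := by
    have := Measure.map_addHaar_smul (volume : Measure (Euc n)) hc.ne'
    rw [finrank_euclideanSpace_fin, abs_of_pos (by positivity)] at this
    exact this
  rw [h2, lintegral_smul_measure] at h1
  exact h1.symm

/-- The integral of `(1 + |z|) ^ (-(n + 1))` over `n`-dimensional space. -/
def decayMass (n : ℕ) : ℝ≥0∞ :=
  ∫⁻ z : Euc n, ENNReal.ofReal (((1 + ‖z‖) ^ (n + 1))⁻¹)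

theorem decayMass_lt_top (n : ℕ) : decayMass n < ∞ := by
  have h := finite_integral_one_add_norm (μ := (volume : Measure (Euc n))) (r := (n + 1 : ℕ))
    (by rw [finrank_euclideanSpace_fin]; push_cast; linarith)
  refine lt_of_eq_of_lt (lintegral_congr fun z => ?_) h
  rw [Real.rpow_neg (by positivity), Real.rpow_natCast]

theorem lintegral_decayKernel (lam : ℝ) (hl : 0 < lam) (x : Euc n) :
    ∫⁻ y, decayKernel lam (n + 1) x y = decayMass n := by
  set h : Euc n → ℝ≥0∞ := fun z => ENNReal.ofReal (((1 + ‖z‖) ^ (n + 1))⁻¹) with hh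
  have h1 : ∀ y, decayKernel lam (n + 1) x y = ENNReal.ofReal (lam ^ n) * h (lam • (y - x)) := by
    intro y
    rw [hh, decayKernel, ← ENNReal.ofReal_mul (by positivity), norm_smul,
      Real.norm_of_nonneg hl.le]
  simp_rw [h1]
  rw [lintegral_const_mul' _ _ ENNReal.ofReal_ne_top,
    lintegral_sub_right_eq_self (fun z => h (lam • z)) x, lintegral_comp_smul lam hl, ← mul_assoc,
    ← ENNReal.ofReal_mul (by positivity), mul_inv_cancel₀ (by positivity), ENNReal.ofReal_one,
    one_mul, decayMass]

theorem decayKernel_le_of_mem_dyadicCube {J : ℤ} {M : Fin n → ℤ} (m : ℕ) (x : Euc n) {y y' : Euc n}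
    (hy : y ∈ dyadicCube J M) (hy' : y' ∈ dyadicCube J M) :
    decayKernel ((2 : ℝ) ^ J) m x y ≤
      ENNReal.ofReal ((1 + n) ^ m) * decayKernel ((2 : ℝ) ^ J) m x y' := by
  rw [decayKernel, decayKernel, ← ENNReal.ofReal_mul (by positivity)]
  refine ENNReal.ofReal_le_ofReal ?_
  set lam : ℝ := (2 : ℝ) ^ J with hl
  have hl0 : 0 < lam := by positivity
  have h1 : lam * ‖y' - y‖ ≤ n := by
    have := mul_le_mul_of_nonneg_left (norm_sub_le_of_mem_dyadicCube hy' hy) hl0.le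
    rwa [mul_left_comm, hl, ← zpow_add₀ (by norm_num), add_neg_cancel, zpow_zero, mul_one] at this
  have h2 : 1 + lam * ‖y' - x‖ ≤ (1 + n) * (1 + lam * ‖y - x‖) := by
    have h3 : ‖y' - x‖ ≤ ‖y' - y‖ + ‖y - x‖ := norm_sub_le_norm_sub_add_norm_sub _ _ _
    have h4 := mul_le_mul_of_nonneg_left h3 hl0.le
    have h5 : 0 ≤ lam * ‖y - x‖ := by positivity
    have h6 : (0 : ℝ) ≤ n := by positivity
    nlinarith
  rw [mul_left_comm]
  gcongr
  rw [← div_eq_mul_inv, le_div_iff₀ (by positivity), inv_mul_le_iff₀ (by positivity), ← mul_pow,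
    mul_comm (1 + lam * ‖y - x‖)]
  gcongr

/-- The largest mean value of `h` over the dyadic cubes of side length `2 ^ (-J)`. -/
def cubeMean (J : ℤ) (h : Euc n → ℝ≥0∞) : ℝ≥0∞ :=
  ⨆ M : Fin n → ℤ, ENNReal.ofReal (((2 : ℝ) ^ J) ^ n) * ∫⁻ y in dyadicCube J M, h y

/-- Means against a decaying kernel of width `2 ^ (-J)` are controlled by means over dyadic cubes of
the same scale, since the kernel is essentially constant on each cube. -/
theorem lintegral_decayKernel_mul_le (J : ℤ) (x : Euc n) (h : Euc n → ℝ≥0∞) :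
    ∫⁻ y, decayKernel ((2 : ℝ) ^ J) (n + 1) x y * h y ≤
      ENNReal.ofReal ((1 + n) ^ (n + 1)) * decayMass n * cubeMean J h := by
  set w := decayKernel ((2 : ℝ) ^ J) (n + 1) x with hw
  set D := ENNReal.ofReal ((1 + (n : ℝ)) ^ (n + 1)) with hD
  have hcube : ∀ M : Fin n → ℤ, ∫⁻ y in dyadicCube J M, w y * h y ≤
      D * cubeMean J h * ∫⁻ y in dyadicCube J M, w y := by
    intro M
    set Q := dyadicCube J M with hQ
    have hQm : MeasurableSet Q := measurableSet_dyadicCube J M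
    set v := ENNReal.ofReal (((2 : ℝ) ^ J) ^ n) with hv
    have hvol : v * volume Q = 1 := by
      rw [hQ, volume_dyadicCube, hv, ← ENNReal.ofReal_mul (by positivity), ← mul_pow,
        ← zpow_add₀ (by norm_num), add_neg_cancel, zpow_zero, one_pow, ENNReal.ofReal_one]
    have hpt : ∀ y' ∈ Q, v * ∫⁻ y in Q, w y * h y ≤ D * cubeMean J h * w y' := by
      intro y' hy'
      have h1 : ∫⁻ y in Q, w y * h y ≤ D * w y' * ∫⁻ y in Q, h y := by
        have hfin : D * w y' ≠ ∞ := ENNReal.mul_ne_top ENNReal.ofReal_ne_top ENNReal.ofReal_ne_top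
        rw [← lintegral_const_mul' _ _ hfin]
        refine setLIntegral_mono' hQm fun y hy => ?_
        gcongr
        exact decayKernel_le_of_mem_dyadicCube (n + 1) x hy hy'
      calc v * ∫⁻ y in Q, w y * h y ≤ v * (D * w y' * ∫⁻ y in Q, h y) := by gcongr
        _ = D * (v * ∫⁻ y in Q, h y) * w y' := by ring
        _ ≤ D * cubeMean J h * w y' := by
            gcongr
            exact le_iSup (fun M : Fin n → ℤ =>
              ENNReal.ofReal (((2 : ℝ) ^ J) ^ n) * ∫⁻ y in dyadicCube J M, h y) M
    -- an infinite mean makes the right-hand side infinite unless the kernel vanishes on `Q`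
    by_cases htop : D * cubeMean J h = ∞
    · rcases eq_or_ne (∫⁻ y in Q, w y) 0 with h0 | h0
      · have hwm : Measurable w := by
          rw [hw]; unfold decayKernel; fun_prop
        rw [lintegral_eq_zero_iff hwm] at h0
        have : ∫⁻ y in Q, w y * h y = 0 := by
          refine (lintegral_congr_ae ?_).trans lintegral_zero
          filter_upwards [h0] with y hy
          rw [hy]; simp
        rw [this]; exact zero_le
      · rw [htop, ENNReal.top_mul h0]; exact le_top
    -- average the pointwise bound `hpt` over `y' ∈ Q`
    · calc ∫⁻ y in Q, w y * h y = ∫⁻ _ in Q, v * ∫⁻ y in Q, w y * h y := by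
            rw [setLIntegral_const, mul_right_comm, hvol, one_mul]
        _ ≤ ∫⁻ y' in Q, D * cubeMean J h * w y' := setLIntegral_mono' hQm hpt
        _ = _ := lintegral_const_mul' _ _ htop
  rw [lintegral_eq_tsum_dyadicCube J]
  refine (ENNReal.tsum_le_tsum hcube).trans ?_
  rw [ENNReal.tsum_mul_left, ← lintegral_eq_tsum_dyadicCube J,
    lintegral_decayKernel _ (by positivity)]
  exact le_of_eq (by ring)

/-- The weight `(1 + lam |y - x|) ^ a`. -/
def growthWeight (lam : ℝ) (a : ℕ) (x y : Euc n) : ℝ≥0∞ :=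
  ENNReal.ofReal ((1 + lam * ‖y - x‖) ^ a)

theorem one_le_growthWeight {lam : ℝ} (hl : 0 < lam) (a : ℕ) (x y : Euc n) :
    1 ≤ growthWeight lam a x y := by
  rw [growthWeight, ENNReal.one_le_ofReal]
  exact one_le_pow₀ (by linarith [mul_nonneg hl.le (norm_nonneg (y - x))])

theorem growthWeight_self (lam : ℝ) (a : ℕ) (x : Euc n) : growthWeight lam a x x = 1 := by
  simp [growthWeight]

/-- The growth weight centred at `x` is absorbed by a part of the decay of the kernel at the cost of
its value at the centre `z` of the kernel. -/
theorem decayKernel_mul_growthWeight_le {lam : ℝ} (hl : 0 < lam) (a m : ℕ) (x z y : Euc n) :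
    decayKernel lam (a + m) z y * growthWeight lam a x y ≤
      growthWeight lam a x z * decayKernel lam m z y := by
  rw [decayKernel, decayKernel, growthWeight, growthWeight, ← ENNReal.ofReal_mul (by positivity),
    ← ENNReal.ofReal_mul (by positivity)]
  refine ENNReal.ofReal_le_ofReal ?_
  have h1 : 1 + lam * ‖y - x‖ ≤ (1 + lam * ‖z - x‖) * (1 + lam * ‖y - z‖) := by
    have h3 : ‖y - x‖ ≤ ‖y - z‖ + ‖z - x‖ := norm_sub_le_norm_sub_add_norm_sub _ _ _
    have h4 := mul_le_mul_of_nonneg_left h3 hl.le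
    have h5 : 0 ≤ (lam * ‖z - x‖) * (lam * ‖y - z‖) := by positivity
    nlinarith
  calc lam ^ n * ((1 + lam * ‖y - z‖) ^ (a + m))⁻¹ * (1 + lam * ‖y - x‖) ^ a
      ≤ lam ^ n * ((1 + lam * ‖y - z‖) ^ (a + m))⁻¹ *
          ((1 + lam * ‖z - x‖) * (1 + lam * ‖y - z‖)) ^ a := by gcongr
    _ = _ := by
        have : (1 + lam * ‖y - z‖) ≠ 0 := by positivity
        rw [pow_add, mul_pow]
        field_simp

/-- A function reproduced by a rapidly decaying kernel and growing at most like `|z| ^ a` is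
controlled pointwise by its `L_p` means over dyadic cubes, `0 < p ≤ 1`. The maximal function
`sup_z |g z| / (1 + 2 ^ J |z - x|) ^ a` is finite, hence can be cancelled after estimating
`|g| = |g| ^ p |g| ^ (1 - p)`. -/
theorem enorm_rpow_le_of_growth {p : ℝ} (hp : 0 < p) (hp1 : p ≤ 1) (J : ℤ) (a : ℕ) (D : ℝ≥0)
    (g : Euc n → ℂ)
    (hrep : ∀ z, ‖g z‖ₑ ≤ D * ∫⁻ y, decayKernel ((2 : ℝ) ^ J) (a + (n + 1)) z y * ‖g y‖ₑ)
    (x : Euc n) (B : ℝ≥0∞) (hB : B ≠ ∞)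
    (hgrow : ∀ z, ‖g z‖ₑ ≤ B * growthWeight ((2 : ℝ) ^ J) a x z) :
    ‖g x‖ₑ ^ p ≤ D * (ENNReal.ofReal ((1 + n) ^ (n + 1)) * decayMass n *
      cubeMean J fun y => ‖g y‖ₑ ^ p) := by
  set lam : ℝ := (2 : ℝ) ^ J with hl
  have hl0 : 0 < lam := by positivity
  set A := ENNReal.ofReal ((1 + (n : ℝ)) ^ (n + 1)) * decayMass n *
      cubeMean J fun y => ‖g y‖ₑ ^ p with hA
  set b := growthWeight lam a x with hb
  have hb1 : ∀ y, 1 ≤ b y := one_le_growthWeight hl0 a x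
  have hbt : ∀ y, b y ≠ ∞ := fun y => ENNReal.ofReal_ne_top
  have hb0 : ∀ y, b y ≠ 0 := fun y => (zero_lt_one.trans_le (hb1 y)).ne'
  set S : ℝ≥0∞ := ⨆ z, ‖g z‖ₑ / b z with hS
  have hSB : S ≤ B := iSup_le fun z =>
    (ENNReal.div_le_iff (hb0 z) (hbt z)).2 (hgrow z)
  have hSt : S ≠ ∞ := (hSB.trans_lt hB.lt_top).ne
  have hgS : ∀ y, ‖g y‖ₑ ≤ S * b y := fun y =>
    (ENNReal.div_le_iff (hb0 y) (hbt y)).1 (le_iSup (fun z => ‖g z‖ₑ / b z) y)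
  have hp1' : 0 ≤ 1 - p := by linarith
  have hpt : ∀ y, ‖g y‖ₑ ≤ S ^ (1 - p) * (b y * ‖g y‖ₑ ^ p) := by
    intro y
    calc ‖g y‖ₑ = ‖g y‖ₑ ^ (1 - p) * ‖g y‖ₑ ^ p := by
          rw [← ENNReal.rpow_add_of_nonneg _ _ hp1' hp.le]; simp
      _ ≤ (S * b y) ^ (1 - p) * ‖g y‖ₑ ^ p := by gcongr; exact hgS y
      _ = S ^ (1 - p) * (b y ^ (1 - p) * ‖g y‖ₑ ^ p) := by
          rw [ENNReal.mul_rpow_of_nonneg _ _ hp1', mul_assoc]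
      _ ≤ S ^ (1 - p) * (b y * ‖g y‖ₑ ^ p) := by
          gcongr
          calc b y ^ (1 - p) ≤ b y ^ (1 : ℝ) :=
                ENNReal.rpow_le_rpow_of_exponent_le (hb1 y) (by linarith)
            _ = b y := ENNReal.rpow_one _
  have hSp : S ^ (1 - p) ≠ ∞ := ENNReal.rpow_ne_top_of_nonneg hp1' hSt
  have hS1 : S ≤ S ^ (1 - p) * (D * A) := by
    refine iSup_le fun z => (ENNReal.div_le_iff (hb0 z) (hbt z)).2 ((hrep z).trans ?_)
    have h1 : ∫⁻ y, decayKernel lam (a + (n + 1)) z y * ‖g y‖ₑ ≤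
        S ^ (1 - p) * b z * ∫⁻ y, decayKernel lam (n + 1) z y * ‖g y‖ₑ ^ p := by
      rw [← lintegral_const_mul' _ _ (ENNReal.mul_ne_top hSp (hbt z))]
      refine lintegral_mono fun y => ?_
      calc decayKernel lam (a + (n + 1)) z y * ‖g y‖ₑ
          ≤ decayKernel lam (a + (n + 1)) z y * (S ^ (1 - p) * (b y * ‖g y‖ₑ ^ p)) := by
            gcongr; exact hpt y
        _ = S ^ (1 - p) * (decayKernel lam (a + (n + 1)) z y * b y) * ‖g y‖ₑ ^ p := by ring
        _ ≤ S ^ (1 - p) * (b z * decayKernel lam (n + 1) z y) * ‖g y‖ₑ ^ p := by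
            exact mul_le_mul_left (mul_le_mul_right
              (decayKernel_mul_growthWeight_le hl0 a (n + 1) x z y) _) _
        _ = _ := by ring
    calc (D : ℝ≥0∞) * ∫⁻ y, decayKernel lam (a + (n + 1)) z y * ‖g y‖ₑ
        ≤ D * (S ^ (1 - p) * b z * A) := by
          gcongr
          exact h1.trans (by gcongr; exact lintegral_decayKernel_mul_le J z _)
      _ = _ := by ring
  have hgx : ‖g x‖ₑ ≤ S := by simpa [hb, growthWeight_self] using hgS x
  rcases eq_or_ne S 0 with h0 | h0
  · have : ‖g x‖ₑ = 0 := le_antisymm (hgx.trans h0.le) zero_le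
    rw [this, ENNReal.zero_rpow_of_pos hp]
    exact zero_le
  · refine (ENNReal.rpow_le_rpow hgx hp.le).trans ?_
    have hne : S ^ (1 - p) ≠ 0 := by simp [h0, hSt]
    rw [← ENNReal.mul_le_mul_iff_right hne hSp, ← ENNReal.rpow_add _ _ h0 hSt]
    simpa using hS1

/-- The Plancherel-Polya-Nikol'skii inequality for `p ≤ 1`, for the functions `f_j`. -/
theorem Generator.enorm_piece_rpow_le (φ : Generator n) {p : ℝ} (hp : 0 < p) (hp1 : p ≤ 1) :
    ∃ C : ℝ≥0, ∀ (f : 𝓢'(Euc n, ℂ)) (j : ℕ) (x : Euc n),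
      ‖φ.piece f j x‖ₑ ^ p ≤ C * cubeMean (j : ℤ) fun y => ‖φ.piece f j y‖ₑ ^ p := by
  choose D hD using φ.enorm_piece_le_lintegral
  have hcn : ENNReal.ofReal ((1 + (n : ℝ)) ^ (n + 1)) * decayMass n ≠ ∞ :=
    ENNReal.mul_ne_top ENNReal.ofReal_ne_top (decayMass_lt_top n).ne
  refine ⟨D (0 + (n + 1)) * (ENNReal.ofReal ((1 + (n : ℝ)) ^ (n + 1)) * decayMass n).toNNReal + 1,
    fun f j x => ?_⟩
  set g := φ.piece f j with hg
  have hrep : ∀ a z, ‖g z‖ₑ ≤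
      D (a + (n + 1)) * ∫⁻ y, decayKernel ((2 : ℝ) ^ (j : ℤ)) (a + (n + 1)) z y * ‖g y‖ₑ := by
    intro a z
    rw [zpow_natCast]
    exact hD (a + (n + 1)) f j z
  set A := cubeMean (j : ℤ) fun y => ‖g y‖ₑ ^ p with hA
  rcases eq_or_ne A ∞ with hAt | hAt
  · rw [hAt, ENNReal.mul_top (by simp)]
    exact le_top
  -- polynomial growth yields boundedness, with a bound depending on the order of growth
  obtain ⟨C, a, hC0, hC⟩ := exists_norm_bandPart_le f
    (dilate (2 * Real.pi) (by positivity) (φ.phi j))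
  have hlam : (1 : ℝ) ≤ (2 : ℝ) ^ (j : ℤ) := by
    rw [zpow_natCast]; exact one_le_pow₀ (by norm_num)
  obtain ⟨B, hB, hbdd⟩ : ∃ B : ℝ≥0∞, B ≠ ∞ ∧ ∀ z, ‖g z‖ₑ ≤ B := by
    refine ⟨(D (a + (n + 1)) *
      (ENNReal.ofReal ((1 + (n : ℝ)) ^ (n + 1)) * decayMass n * A)) ^ (1 / p),
      ENNReal.rpow_ne_top_of_nonneg (by positivity) (ENNReal.mul_ne_top ENNReal.coe_ne_top
        (ENNReal.mul_ne_top hcn hAt)), fun z => ?_⟩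
    rw [one_div, ENNReal.le_rpow_inv_iff hp]
    refine enorm_rpow_le_of_growth hp hp1 j a _ g (hrep a) z
      (ENNReal.ofReal (C * (1 + ‖z‖) ^ a)) ENNReal.ofReal_ne_top fun y => ?_
    rw [growthWeight, ← ENNReal.ofReal_mul (by positivity), ← ofReal_norm]
    refine ENNReal.ofReal_le_ofReal ((hC y).trans ?_)
    rw [mul_assoc, ← mul_pow]
    gcongr
    have h1 : ‖y‖ ≤ ‖z‖ + ‖y - z‖ := by simpa using norm_add_le z (y - z)
    have h2 : ‖y - z‖ ≤ (2 : ℝ) ^ (j : ℤ) * ‖y - z‖ := le_mul_of_one_le_left (norm_nonneg _) hlam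
    have h3 : 0 ≤ ‖z‖ * ((2 : ℝ) ^ (j : ℤ) * ‖y - z‖) := by positivity
    nlinarith
  -- boundedness permits the growth order `0`, for which the constant depends on `n` and `φ` only
  refine le_trans ?_ (mul_le_mul_left (ENNReal.coe_le_coe.2 le_self_add) A)
  rw [ENNReal.coe_mul, ENNReal.coe_toNNReal hcn, mul_assoc]
  refine enorm_rpow_le_of_growth hp hp1 j 0 _ g (hrep 0) x B hB fun y => ?_
  simpa [growthWeight] using hbdd y

/-! ### Sufficient conditions for the embeddings -/

theorem lpOn_mono {p : ℝ} (hp : 0 < p) (Q : Set (Euc n)) {h h' : Euc n → ℝ≥0∞}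
    (hh : ∀ x, h x ≤ h' x) : lpOn p Q h ≤ lpOn p Q h' := by
  unfold lpOn
  gcongr with x
  exact hh x

theorem lpOn_const_mul {p : ℝ} (hp : 0 < p) (Q : Set (Euc n)) {c : ℝ≥0∞} (hc : c ≠ ∞)
    (h : Euc n → ℝ≥0∞) : lpOn p Q (fun x => c * h x) = c * lpOn p Q h := by
  unfold lpOn
  simp_rw [ENNReal.mul_rpow_of_nonneg _ _ hp.le]
  rw [lintegral_const_mul' _ _ (ENNReal.rpow_ne_top_of_nonneg hp.le hc),
    ENNReal.mul_rpow_of_nonneg _ _ (by positivity), ← ENNReal.rpow_mul, mul_one_div_cancel hp.ne',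
    ENNReal.rpow_one]

theorem le_lqSeq {q : ℝ≥0∞} (hq : 0 < q) (a : ℕ → ℝ≥0∞) (j : ℕ) : a j ≤ lqSeq q a := by
  unfold lqSeq
  split_ifs with h
  · exact le_iSup a j
  · have hq' : 0 < q.toReal := ENNReal.toReal_pos hq.ne' h
    rw [one_div, ENNReal.le_rpow_inv_iff hq']
    exact ENNReal.le_tsum j

/-- For `q ≤ 1` the space `ℓ_q` is contained in `ℓ_1`, with norm one. -/
theorem tsum_le_lqSeq {q : ℝ≥0∞} (hq : 0 < q) (hq1 : q ≤ 1) (a : ℕ → ℝ≥0∞) :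
    ∑' j, a j ≤ lqSeq q a := by
  have hqt : q ≠ ∞ := (hq1.trans_lt ENNReal.one_lt_top).ne
  have hq' : 0 < q.toReal := ENNReal.toReal_pos hq.ne' hqt
  have hq1' : q.toReal ≤ 1 := ENNReal.toReal_le_of_le_ofReal zero_le_one (by simpa using hq1)
  rw [lqSeq, if_neg hqt, one_div, ENNReal.le_rpow_inv_iff hq', ← ENNReal.le_rpow_inv_iff hq',
    ENNReal.tsum_eq_iSup_sum]
  refine iSup_le fun s => ?_
  rw [ENNReal.le_rpow_inv_iff hq']
  refine le_trans ?_ (ENNReal.sum_le_tsum s)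
  induction s using Finset.cons_induction with
  | empty => simp [hq']
  | cons i s hi ih =>
    rw [Finset.sum_cons, Finset.sum_cons]
    exact (ENNReal.rpow_add_le_add_rpow _ _ hq'.le hq1').trans (by gcongr)

theorem lqSeq_mono {q : ℝ≥0∞} {a b : ℕ → ℝ≥0∞} (h : ∀ j, a j ≤ b j) :
    lqSeq q a ≤ lqSeq q b := by
  unfold lqSeq
  split_ifs with hq
  · exact iSup_mono h
  · gcongr with j
    exact h j

/-- The Morrey quasi-norm restricted to the dyadic cubes of side length `2 ^ (-J)`. -/
def levelNorm (ϱ p : ℝ) (J : ℤ) (h : Euc n → ℝ≥0∞) : ℝ≥0∞ :=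
  ⨆ M : Fin n → ℤ, weight n ϱ p J * lpOn p (dyadicCube J M) h

theorem levelNorm_le_morreyNorm (ϱ p : ℝ) (J : ℤ) (h : Euc n → ℝ≥0∞) :
    levelNorm ϱ p J h ≤ morreyNorm ϱ p h :=
  le_iSup (fun J : ℤ => levelNorm ϱ p J h) J

theorem morreyNorm_mono {ϱ p : ℝ} (hp : 0 < p) {h h' : Euc n → ℝ≥0∞} (hh : ∀ x, h x ≤ h' x) :
    morreyNorm ϱ p h ≤ morreyNorm ϱ p h' := by
  unfold morreyNorm
  gcongr
  exact lpOn_mono hp _ hh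

theorem levelNorm_le_lowerB (φ : Generator n) (ϱ s p : ℝ) {q : ℝ≥0∞} (hq : 0 < q)
    (f : 𝓢'(Euc n, ℂ)) (j : ℕ) :
    levelNorm ϱ p j (φ.scaled s f j) ≤ lowerB φ ϱ s p q f :=
  (levelNorm_le_morreyNorm ϱ p j _).trans
    (le_lqSeq hq (fun j => morreyNorm ϱ p (φ.scaled s f j)) j)

theorem levelNorm_le_lowerF (φ : Generator n) (ϱ s : ℝ) {p : ℝ} (hp : 0 < p) {q : ℝ≥0∞}
    (hq : 0 < q) (f : 𝓢'(Euc n, ℂ)) (j : ℕ) :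
    levelNorm ϱ p j (φ.scaled s f j) ≤ lowerF φ ϱ s p q f :=
  (levelNorm_le_morreyNorm ϱ p j _).trans
    (morreyNorm_mono hp fun x => le_lqSeq hq (fun j => φ.scaled s f j x) j)

theorem levelNorm_le_upperB (φ : Generator n) (ϱ s p : ℝ) {q : ℝ≥0∞} (hq : 0 < q)
    (f : 𝓢'(Euc n, ℂ)) (j : ℕ) :
    levelNorm ϱ p j (φ.scaled s f j) ≤ upperB φ ϱ s p q f := by
  refine iSup_le fun M => le_trans ?_ (le_iSup₂ (f := fun (J : ℤ) (M : Fin n → ℤ) =>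
    weight n ϱ p J * lqSeq q fun j =>
      if J.toNat ≤ j then lpOn p (dyadicCube J M) (φ.scaled s f j) else 0) (j : ℤ) M)
  gcongr
  refine le_trans ?_ (le_lqSeq hq _ j)
  simp

theorem levelNorm_le_upperF (φ : Generator n) (ϱ s : ℝ) {p : ℝ} (hp : 0 < p) {q : ℝ≥0∞}
    (hq : 0 < q) (f : 𝓢'(Euc n, ℂ)) (j : ℕ) :
    levelNorm ϱ p j (φ.scaled s f j) ≤ upperF φ ϱ s p q f := by
  refine iSup_le fun M => le_trans ?_ (le_iSup₂ (f := fun (J : ℤ) (M : Fin n → ℤ) =>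
    weight n ϱ p J * lpOn p (dyadicCube J M) fun x => lqSeq q fun j =>
      if J.toNat ≤ j then φ.scaled s f j x else 0) (j : ℤ) M)
  gcongr
  refine lpOn_mono hp _ fun x => le_trans ?_ (le_lqSeq hq _ j)
  simp

/-- Hölder's inequality for the mean values over a dyadic cube: the mean of `|g| ^ p₀` is at most
the `p₀ / p`-th power of the mean of `|g| ^ p`. -/
theorem mul_lintegral_rpow_le_lpOn {p : ℝ} (hp : 0 < p) (J : ℤ) {g : Euc n → ℂ}
    (hg : Continuous g) (M : Fin n → ℤ) {p₀ : ℝ} (hp₀ : 0 < p₀) (hp₀p : p₀ ≤ p) :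
    ENNReal.ofReal (((2 : ℝ) ^ J) ^ n) * ∫⁻ y in dyadicCube J M, ‖g y‖ₑ ^ p₀ ≤
      (ENNReal.ofReal (((2 : ℝ) ^ J) ^ n) ^ (1 / p) *
        lpOn p (dyadicCube J M) fun y => ‖g y‖ₑ) ^ p₀ := by
  set v := ENNReal.ofReal (((2 : ℝ) ^ J) ^ n) with hv
  have hv0 : v ≠ 0 := by
    rw [hv, Ne, ENNReal.ofReal_eq_zero, not_le]; positivity
  have hvt : v ≠ ∞ := ENNReal.ofReal_ne_top
  have hvol : volume (dyadicCube J M) = v⁻¹ := by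
    rw [volume_dyadicCube, hv, ← ENNReal.ofReal_inv_of_pos (by positivity), zpow_neg, inv_pow]
  have h1 := eLpNorm'_le_eLpNorm'_mul_rpow_measure_univ (μ := volume.restrict (dyadicCube J M))
    hp₀ hp₀p hg.aestronglyMeasurable
  rw [eLpNorm'_eq_lintegral_enorm, eLpNorm'_eq_lintegral_enorm, Measure.restrict_apply_univ,
    hvol] at h1
  have h2 := ENNReal.rpow_le_rpow h1 hp₀.le
  rw [← ENNReal.rpow_mul, one_div_mul_cancel hp₀.ne', ENNReal.rpow_one] at h2
  have h3 : v * (v⁻¹ ^ (1 / p₀ - 1 / p)) ^ p₀ = (v ^ (1 / p)) ^ p₀ := by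
    rw [← ENNReal.rpow_mul, ← ENNReal.rpow_mul, ENNReal.inv_rpow, ← ENNReal.rpow_neg]
    nth_rewrite 1 [← ENNReal.rpow_one v]
    rw [← ENNReal.rpow_add _ _ hv0 hvt]
    congr 1
    field_simp
    ring
  calc v * ∫⁻ y in dyadicCube J M, ‖g y‖ₑ ^ p₀
      ≤ v * (lpOn p (dyadicCube J M) (fun y => ‖g y‖ₑ) * v⁻¹ ^ (1 / p₀ - 1 / p)) ^ p₀ := by
        gcongr; exact h2
    _ = (v * (v⁻¹ ^ (1 / p₀ - 1 / p)) ^ p₀) *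
          lpOn p (dyadicCube J M) (fun y => ‖g y‖ₑ) ^ p₀ := by
        rw [ENNReal.mul_rpow_of_nonneg _ _ hp₀.le]; ring
    _ = _ := by rw [h3, ENNReal.mul_rpow_of_nonneg _ _ hp₀.le]

/-- The Nikol'skii inequality in Morrey spaces. Only the cubes whose side length is the reciprocal
of the frequency are needed. -/
theorem Generator.enorm_piece_le_levelNorm (φ : Generator n) (ϱ s : ℝ) {p : ℝ} (hp : 0 < p) :
    ∃ C : ℝ≥0, ∀ (f : 𝓢'(Euc n, ℂ)) (j : ℕ) (x : Euc n),
      ‖φ.piece f j x‖ₑ ≤ C * (ENNReal.ofReal ((2 : ℝ) ^ ((j : ℝ) * (-ϱ / p - s))) *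
        levelNorm ϱ p j (φ.scaled s f j)) := by
  -- pass to an exponent at most `1` by Hölder's inequality on each cube
  set p₀ := min p 1 with hp₀
  have hp₀0 : 0 < p₀ := lt_min hp one_pos
  obtain ⟨C, hC⟩ := φ.enorm_piece_rpow_le hp₀0 (min_le_right _ _)
  refine ⟨C ^ (1 / p₀), fun f j x => ?_⟩
  set A := ENNReal.ofReal ((2 : ℝ) ^ ((j : ℝ) * (-ϱ / p - s))) *
        levelNorm ϱ p j (φ.scaled s f j) with hA
  have h1 : ∀ M : Fin n → ℤ, ENNReal.ofReal (((2 : ℝ) ^ (j : ℤ)) ^ n) ^ (1 / p) *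
      lpOn p (dyadicCube (j : ℤ) M) (fun y => ‖φ.piece f j y‖ₑ) ≤ A := by
    intro M
    have h2 : ENNReal.ofReal (((2 : ℝ) ^ (j : ℤ)) ^ n) ^ (1 / p) =
        ENNReal.ofReal ((2 : ℝ) ^ ((j : ℝ) * (-ϱ / p - s))) * (weight n ϱ p j *
          ENNReal.ofReal ((2 : ℝ) ^ ((j : ℝ) * s))) := by
      rw [weight, ENNReal.ofReal_rpow_of_pos (by positivity), ← ENNReal.ofReal_mul (by positivity),
        ← ENNReal.ofReal_mul (by positivity), ← Real.rpow_add two_pos, ← Real.rpow_add two_pos,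
        zpow_natCast, ← pow_mul, ← Real.rpow_natCast, ← Real.rpow_mul two_pos.le]
      congr 2
      push_cast
      field_simp
      ring
    rw [h2, mul_assoc, mul_assoc, hA]
    gcongr
    rw [← lpOn_const_mul hp _ ENNReal.ofReal_ne_top]
    exact le_iSup (fun M : Fin n → ℤ =>
      weight n ϱ p j * lpOn p (dyadicCube (j : ℤ) M) (φ.scaled s f j)) M
  have h3 : (cubeMean (j : ℤ) fun y => ‖φ.piece f j y‖ₑ ^ p₀) ≤ A ^ p₀ := by
    refine iSup_le fun M => (mul_lintegral_rpow_le_lpOn hp j (φ.continuous_piece f j) M hp₀0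
      (min_le_left _ _)).trans ?_
    gcongr
    exact h1 M
  have h4 := (hC f j x).trans (mul_le_mul_right h3 _)
  have h5 := ENNReal.rpow_le_rpow h4 (z := 1 / p₀) (by positivity)
  rwa [← ENNReal.rpow_mul, mul_one_div_cancel hp₀0.ne', ENNReal.rpow_one,
    ENNReal.mul_rpow_of_nonneg _ _ (by positivity), ← ENNReal.rpow_mul, mul_one_div_cancel hp₀0.ne',
    ENNReal.rpow_one, ← ENNReal.coe_rpow_of_nonneg _ (by positivity)] at h5

/-- If the supremum norms of the pieces `f_j` are summable, then their sum is a bounded continuous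
function representing `f`. -/
theorem embedsC_of_tsum_le (φ : Generator n) (N : 𝓢'(Euc n, ℂ) → ℝ≥0∞) (C : ℝ≥0)
    (h : ∀ f, ∑' j, ⨆ x, ‖φ.piece f j x‖ₑ ≤ C * N f) : EmbedsC N := by
  refine ⟨C, fun f hf => ?_⟩
  set a : ℕ → ℝ≥0∞ := fun j => ⨆ x, ‖φ.piece f j x‖ₑ with ha
  have hsum : ∑' j, a j ≠ ∞ := ((h f).trans_lt (ENNReal.mul_lt_top ENNReal.coe_lt_top hf)).ne
  have hat : ∀ j, a j ≠ ∞ := ENNReal.ne_top_of_tsum_ne_top hsum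
  have hb : ∀ j x, ‖φ.piece f j x‖ ≤ (a j).toReal := fun j x => by
    rw [← toReal_enorm]
    exact ENNReal.toReal_mono (hat j) (le_iSup (fun x => ‖φ.piece f j x‖ₑ) x)
  have hsr : Summable fun j => (a j).toReal := ENNReal.summable_toReal hsum
  set g : ℕ → (Euc n →ᵇ ℂ) := fun j =>
    BoundedContinuousFunction.ofNormedAddCommGroup (φ.piece f j) (φ.continuous_piece f j) _ (hb j)
    with hg
  have hgn : ∀ j, ‖g j‖ ≤ (a j).toReal := fun j =>
    BoundedContinuousFunction.norm_ofNormedAddCommGroup_le _ ENNReal.toReal_nonneg _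
  have hgs : Summable g := Summable.of_norm_bounded hsr hgn
  have hgsn : Summable fun j => ‖g j‖ :=
    Summable.of_nonneg_of_le (fun j => norm_nonneg (g j)) hgn hsr
  refine ⟨∑' j, g j, fun ψ => ?_, ?_⟩
  · have hval : ∀ x, (∑' j, g j) x = ∑' j, φ.piece f j x := fun x =>
      ((BoundedContinuousFunction.evalCLM ℂ x).map_tsum hgs)
    have hint : ∀ j, Integrable fun y => ψ y * φ.piece f j y := fun j =>
      ψ.integrable.mul_bdd (φ.continuous_piece f j).aestronglyMeasurable (.of_forall (hb j))
    have h2 := hasSum_integral_of_summable_integral_norm hint (by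
      refine Summable.of_nonneg_of_le (fun j => integral_nonneg fun _ => norm_nonneg _)
        (fun j => ?_) (hsr.mul_left (∫ y, ‖ψ y‖))
      rw [← integral_mul_const]
      refine integral_mono (hint j).norm (ψ.integrable.norm.mul_const _) fun y => ?_
      simp only [norm_mul]
      exact mul_le_mul_of_nonneg_left (hb j y) (norm_nonneg _))
    refine (tendsto_nhds_unique h2.tendsto_sum_nat (φ.tendsto_sum_integral_piece f ψ)).symm.trans
      (integral_congr_ae (.of_forall fun y => ?_))
    simp only [hval, tsum_mul_left]
  · refine le_trans ?_ (h f)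
    rw [← ofReal_norm]
    refine (ENNReal.ofReal_le_ofReal ((norm_tsum_le_tsum_norm hgsn).trans
      (hgsn.tsum_le_tsum hgn hsr))).trans_eq ?_
    rw [← ENNReal.tsum_toReal_eq hat, ENNReal.ofReal_toReal hsum]

/-- If `s > |ϱ| / p`, then control of each piece `f_j` at the scale `2 ^ (-j)` suffices. -/
theorem embedsC_of_lt (φ : Generator n) {ϱ s p : ℝ} (hp : 0 < p) (hϱ : ϱ < 0) (hs : |ϱ| / p < s)
    (N : 𝓢'(Euc n, ℂ) → ℝ≥0∞)
    (hN : ∀ f (j : ℕ), levelNorm ϱ p j (φ.scaled s f j) ≤ N f) : EmbedsC N := by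
  obtain ⟨C, hC⟩ := φ.enorm_piece_le_levelNorm ϱ s hp
  rw [abs_of_neg hϱ] at hs
  set t : ℝ≥0∞ := ENNReal.ofReal ((2 : ℝ) ^ (-ϱ / p - s)) with ht
  have ht1 : t < 1 := by
    rw [ht, ENNReal.ofReal_lt_one]
    exact Real.rpow_lt_one_of_one_lt_of_neg one_lt_two (by linarith)
  have hgeo : ∑' j : ℕ, t ^ j ≠ ∞ := by
    rw [ENNReal.tsum_geometric]
    exact ENNReal.inv_ne_top.2 (tsub_pos_iff_lt.2 ht1).ne'
  refine embedsC_of_tsum_le φ N (C * (∑' j : ℕ, t ^ j).toNNReal) fun f => ?_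
  rw [ENNReal.coe_mul, ENNReal.coe_toNNReal hgeo, mul_assoc, ← ENNReal.tsum_mul_right,
    ← ENNReal.tsum_mul_left]
  refine ENNReal.tsum_le_tsum fun j => iSup_le fun x => (hC f j x).trans ?_
  have : ENNReal.ofReal ((2 : ℝ) ^ ((j : ℝ) * (-ϱ / p - s))) = t ^ j := by
    rw [ht, ← ENNReal.ofReal_pow (by positivity), mul_comm, Real.rpow_mul_natCast two_pos.le]
  rw [this]
  gcongr
  exact hN f j

theorem embedsC_lowerB_of_le_one (φ : Generator n) {ϱ p : ℝ} (hp : 0 < p) (hϱ : ϱ < 0) {q : ℝ≥0∞}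
    (hq : 0 < q) (hq1 : q ≤ 1) : EmbedsC (lowerB φ ϱ (|ϱ| / p) p q) := by
  obtain ⟨C, hC⟩ := φ.enorm_piece_le_levelNorm ϱ (|ϱ| / p) hp
  refine embedsC_of_tsum_le φ _ C fun f => ?_
  refine le_trans ?_ (mul_le_mul_right (tsum_le_lqSeq hq hq1 _) _)
  rw [← ENNReal.tsum_mul_left]
  refine ENNReal.tsum_le_tsum fun j => iSup_le fun x => (hC f j x).trans ?_
  rw [abs_of_neg hϱ, sub_self, mul_zero, Real.rpow_zero, ENNReal.ofReal_one, one_mul]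
  gcongr
  exact levelNorm_le_morreyNorm ϱ p j _

/-! ### Powers of the norm in Morrey spaces -/

theorem lqSeq_const_mul {q : ℝ≥0∞} (hq : 0 < q) (c : ℝ≥0∞) (a : ℕ → ℝ≥0∞) :
    lqSeq q (fun j => c * a j) = c * lqSeq q a := by
  unfold lqSeq
  split_ifs with h
  · rw [ENNReal.mul_iSup]
  · have hq' : 0 < q.toReal := ENNReal.toReal_pos hq.ne' h
    simp_rw [ENNReal.mul_rpow_of_nonneg _ _ hq'.le]
    rw [ENNReal.tsum_mul_left, ENNReal.mul_rpow_of_nonneg _ _ (by positivity), ← ENNReal.rpow_mul,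
      mul_one_div_cancel hq'.ne', ENNReal.rpow_one]

/-- The two-sided geometric sequences `2 ^ (-δ |j - k|)` are bounded in `ℓ_q`, uniformly in `k`. -/
theorem exists_lqSeq_geometric_le {q : ℝ≥0∞} (hq : 0 < q) {δ : ℝ} (hδ : 0 < δ) :
    ∃ K : ℝ≥0, ∀ k : ℤ,
      lqSeq q (fun j => ENNReal.ofReal ((2 : ℝ) ^ (-δ * |((j : ℤ) - k : ℤ)|))) ≤ K := by
  by_cases h : q = ∞
  · refine ⟨1, fun k => ?_⟩
    rw [lqSeq, if_pos h]
    refine iSup_le fun j => ENNReal.ofReal_le_one.2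
      (Real.rpow_le_one_of_one_le_of_nonpos one_le_two ?_)
    nlinarith [show (0 : ℝ) ≤ |((j : ℤ) - k : ℤ)| by positivity]
  have hq' : 0 < q.toReal := ENNReal.toReal_pos hq.ne' h
  set F : ℤ → ℝ≥0∞ := fun m => ENNReal.ofReal ((2 : ℝ) ^ (-δ * |m|)) ^ q.toReal with hF
  have hsum : ∑' m, F m ≠ ∞ := by
    set t : ℝ := (2 : ℝ) ^ (-(δ * q.toReal)) with ht
    have ht1 : t < 1 := Real.rpow_lt_one_of_one_lt_of_neg one_lt_two (by
      have := mul_pos hδ hq'; linarith)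
    have ht0 : 0 ≤ t := by positivity
    have hFt : ∀ m : ℤ, F m = ENNReal.ofReal (t ^ m.natAbs) := by
      intro m
      rw [hF]
      simp only
      rw [ENNReal.ofReal_rpow_of_pos (by positivity), ht, ← Real.rpow_mul_natCast two_pos.le,
        ← Real.rpow_mul two_pos.le]
      congr 2
      have : ((|m| : ℤ) : ℝ) = (m.natAbs : ℝ) := by rw [Int.abs_eq_natAbs, Int.cast_natCast]
      rw [this]; ring
    have hs : Summable fun m : ℤ => t ^ m.natAbs := by
      refine Summable.of_nat_of_neg ?_ ?_
      · simpa using summable_geometric_of_lt_one ht0 ht1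
      · simpa using summable_geometric_of_lt_one ht0 ht1
    simp_rw [hFt]
    rw [← ENNReal.ofReal_tsum_of_nonneg (fun m => by positivity) hs]
    exact ENNReal.ofReal_ne_top
  refine ⟨((∑' m, F m) ^ (1 / q.toReal)).toNNReal, fun k => ?_⟩
  rw [ENNReal.coe_toNNReal (ENNReal.rpow_ne_top_of_nonneg (by positivity) hsum), lqSeq, if_neg h]
  refine ENNReal.rpow_le_rpow ?_ (by positivity)
  have hinj : Function.Injective fun j : ℕ => (j : ℤ) - k := fun a b hab => by
    simp only at hab; omega
  exact ENNReal.tsum_comp_le_tsum_of_injective hinj F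

theorem lintegral_ball_rpow_lt_top (hn : 1 ≤ n) {b : ℝ} (hb : b < n) :
    ∫⁻ x in Metric.ball (0 : Euc n) 1, ‖x‖ₑ ^ (-b) < ∞ := by
  have : Nonempty (Fin n) := ⟨⟨0, hn⟩⟩
  have h := integrableOn_ball_of_norm_le_rpow (μ := (volume : Measure (Euc n))) (r := 1) (C := 1)
    (f := fun x => ‖x‖ ^ (-b)) (α := b) (by simpa using hn) (by simpa using hb)
    (.of_forall fun x => by
      rw [one_mul, Real.norm_of_nonneg (by positivity)])
    (measurable_norm.pow_const _).aestronglyMeasurable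
  refine lt_of_eq_of_lt (lintegral_congr_ae ?_) h.2
  refine ae_restrict_of_ae ?_
  filter_upwards [compl_mem_ae_iff.2 (measure_singleton (0 : Euc n))] with x hx
  have hx' : 0 < ‖x‖ := norm_pos_iff.2 hx
  rw [← ofReal_norm, ← ofReal_norm, ENNReal.ofReal_rpow_of_pos hx',
    Real.norm_of_nonneg (by positivity)]

/-- The power `|x| ^ (-b)` with `b < n` has the largest integrals over cubes near the origin. -/
theorem lintegral_dyadicCube_rpow_le (hn : 1 ≤ n) {b : ℝ} (hb0 : 0 ≤ b) (hb : b < n) :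
    ∃ C : ℝ≥0, ∀ (J : ℤ) (M : Fin n → ℤ), ∫⁻ x in dyadicCube J M, ‖x‖ₑ ^ (-b) ≤
      C * ENNReal.ofReal ((2 : ℝ) ^ (-(J : ℝ) * (n - b))) := by
  have hfin := lintegral_ball_rpow_lt_top hn hb
  set I := ∫⁻ x in Metric.ball (0 : Euc n) 1, ‖x‖ₑ ^ (-b) with hI
  refine ⟨I.toNNReal + 1, fun J M => ?_⟩
  rw [ENNReal.coe_add, ENNReal.coe_toNNReal hfin.ne, ENNReal.coe_one, add_mul, one_mul]
  set R : ℝ := (2 : ℝ) ^ (-J) with hR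
  have hR0 : 0 < R := by positivity
  have hRn : ENNReal.ofReal ((2 : ℝ) ^ (-(J : ℝ) * (n - b))) =
      ENNReal.ofReal (R ^ (-b)) * ENNReal.ofReal (R ^ n) := by
    rw [← ENNReal.ofReal_mul (by positivity), hR, ← Real.rpow_intCast, ← Real.rpow_natCast,
      ← Real.rpow_mul two_pos.le, ← Real.rpow_mul two_pos.le, ← Real.rpow_add two_pos]
    congr 2
    push_cast
    ring
  set B := Metric.ball (0 : Euc n) R with hB
  have hBm : MeasurableSet B := measurableSet_ball
  have hQm := measurableSet_dyadicCube J M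
  -- inside the ball the integral is scaled to the unit ball, outside it the integrand is at most
  -- `R ^ (-b)`
  rw [← lintegral_inter_add_sdiff _ _ hBm]
  refine add_le_add ?_ ?_
  · refine (lintegral_mono_set Set.inter_subset_right).trans (le_of_eq ?_)
    have h1 := lintegral_comp_smul (n := n) R⁻¹ (by positivity)
      ((Metric.ball 0 1).indicator fun x => ‖x‖ₑ ^ (-b))
    rw [lintegral_indicator measurableSet_ball, inv_pow, inv_inv, ← hI] at h1
    have h2 : ∀ x : Euc n, (Metric.ball (0 : Euc n) 1).indicator (fun x => ‖x‖ₑ ^ (-b)) (R⁻¹ • x) =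
        ENNReal.ofReal (R ^ b) * B.indicator (fun x => ‖x‖ₑ ^ (-b)) x := by
      intro x
      have hmem : R⁻¹ • x ∈ Metric.ball (0 : Euc n) 1 ↔ x ∈ B := by
        rw [hB, mem_ball_zero_iff, mem_ball_zero_iff, norm_smul, norm_inv,
          Real.norm_of_nonneg hR0.le, inv_mul_lt_iff₀ hR0, mul_one]
      by_cases hx : x ∈ B
      · rw [Set.indicator_of_mem hx, Set.indicator_of_mem (hmem.2 hx), enorm_smul,
          ENNReal.mul_rpow_of_ne_top (by simp) (by simp), Real.enorm_of_nonneg (by positivity),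
          ENNReal.ofReal_rpow_of_pos (by positivity), Real.inv_rpow hR0.le, Real.rpow_neg hR0.le,
          inv_inv]
      · rw [Set.indicator_of_notMem hx, Set.indicator_of_notMem (mt hmem.1 hx), mul_zero]
    simp_rw [h2] at h1
    rw [lintegral_const_mul' _ _ ENNReal.ofReal_ne_top, lintegral_indicator hBm] at h1
    rw [hRn, mul_comm I, mul_assoc, ← h1, ← mul_assoc, ← ENNReal.ofReal_mul (by positivity),
      ← Real.rpow_add hR0, neg_add_cancel, Real.rpow_zero, ENNReal.ofReal_one, one_mul]
  · rw [hRn, ← volume_dyadicCube J M, ← setLIntegral_const]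
    refine (setLIntegral_mono' (hQm.diff hBm) fun x hx => ?_).trans
      (lintegral_mono_set Set.sdiff_subset)
    have hx' : R ≤ ‖x‖ := by simpa [hB] using hx.2
    rw [← ofReal_norm, ENNReal.ofReal_rpow_of_pos (hR0.trans_le hx')]
    exact ENNReal.ofReal_le_ofReal (Real.rpow_le_rpow_of_nonpos hR0 hx' (by linarith))

theorem lpOn_dyadicCube_rpow_le (hn : 1 ≤ n) {p : ℝ} (hp : 0 < p) {a : ℝ} (ha0 : 0 ≤ a)
    (ha : a * p < n) :
    ∃ C : ℝ≥0, ∀ (J : ℤ) (M : Fin n → ℤ), lpOn p (dyadicCube J M) (fun x => ‖x‖ₑ ^ (-a)) ≤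
      C * ENNReal.ofReal ((2 : ℝ) ^ (-(J : ℝ) * (n / p - a))) := by
  obtain ⟨C, hC⟩ := lintegral_dyadicCube_rpow_le hn (b := a * p) (by positivity) ha
  refine ⟨C ^ (1 / p), fun J M => ?_⟩
  have h := ENNReal.rpow_le_rpow (hC J M) (z := 1 / p) (by positivity)
  rw [ENNReal.mul_rpow_of_nonneg _ _ (by positivity),
    ← ENNReal.coe_rpow_of_nonneg _ (by positivity), ENNReal.ofReal_rpow_of_pos (by positivity),
    ← Real.rpow_mul two_pos.le] at h
  unfold lpOn
  simp_rw [← ENNReal.rpow_mul]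
  rw [neg_mul a p]
  refine h.trans_eq ?_
  congr 3
  field_simp

/-- The function `|x| ^ (-|ϱ| / p)` belongs to the Morrey space `Λ^ϱ_p`. -/
theorem morreyNorm_rpow_lt_top (hn : 1 ≤ n) {p ϱ : ℝ} (hp : 0 < p) (hϱ : -(n : ℝ) < ϱ)
    (hϱ0 : ϱ < 0) : morreyNorm ϱ p (fun x : Euc n => ‖x‖ₑ ^ (-(|ϱ| / p))) < ∞ := by
  obtain ⟨C, hC⟩ := lpOn_dyadicCube_rpow_le hn hp (a := |ϱ| / p) (by positivity)
    (by rw [div_mul_cancel₀ _ hp.ne', abs_of_neg hϱ0]; linarith)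
  refine lt_of_le_of_lt (iSup₂_le fun J M => ?_) (ENNReal.coe_lt_top (r := C))
  refine (mul_le_mul_right (hC J M) _).trans_eq ?_
  rw [weight, mul_left_comm, ← ENNReal.ofReal_mul (by positivity), ← Real.rpow_add two_pos,
    abs_of_neg hϱ0]
  have : (J : ℝ) / p * (n + ϱ) + -(J : ℝ) * (n / p - -ϱ / p) = 0 := by field_simp; ring
  rw [this, Real.rpow_zero, ENNReal.ofReal_one, mul_one]

/-! ### Frequency pieces of lacunary sums -/

/-- The function `ξ ↦ θ ((2 π)⁻¹ ξ)` vanishes outside the annulus `3 / 2 ≤ |ξ| ≤ 2`. The factor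
`2 π` is the one between the arguments of Mathlib's Fourier transform and of the resolution of
unity. -/
def SupportedInAnnulus (θ : 𝓢(Euc n, ℂ)) : Prop :=
  ∀ ξ, θ ξ ≠ 0 → 3 / 2 ≤ ‖(2 * Real.pi) • ξ‖ ∧ ‖(2 * Real.pi) • ξ‖ ≤ 2

theorem exists_annulus_bump (hn : 1 ≤ n) :
    ∃ θ : 𝓢(Euc n, ℂ), (∫ ξ, θ ξ) ≠ 0 ∧ SupportedInAnnulus θ := by
  have h2pi : 0 < 2 * Real.pi := by positivity
  obtain ⟨c, hcn⟩ : ∃ c : Euc n, ‖(2 * Real.pi) • c‖ = 7 / 4 := by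
    refine ⟨(2 * Real.pi)⁻¹ • EuclideanSpace.single ⟨0, hn⟩ (7 / 4), ?_⟩
    rw [smul_inv_smul₀ h2pi.ne', PiLp.norm_single]
    norm_num
  obtain ⟨r, hr, hr4⟩ : ∃ r : ℝ, 0 < r ∧ 2 * Real.pi * r = 1 / 4 :=
    ⟨(2 * Real.pi)⁻¹ * (1 / 4), by positivity, mul_inv_cancel_left₀ h2pi.ne' _⟩
  obtain ⟨b, hb⟩ : ∃ b : ContDiffBump c, b.rOut = r :=
    ⟨⟨r / 2, r, half_pos hr, half_lt_self hr⟩, rfl⟩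
  have hcs : HasCompactSupport (fun x => (b x : ℂ)) :=
    b.hasCompactSupport.comp_left Complex.ofReal_zero
  have hcd : ContDiff ℝ (⊤ : ℕ∞) (fun x => (b x : ℂ)) :=
    Complex.ofRealCLM.contDiff.comp b.contDiff
  have hval : ∀ ξ, hcs.toSchwartzMap hcd ξ = (b ξ : ℂ) := fun ξ => rfl
  refine ⟨hcs.toSchwartzMap hcd, ?_, fun ξ hξ => ?_⟩
  · simp_rw [hval]
    have h1 : (∫ x, ((b x : ℝ) : ℂ)) = ((∫ x, b x : ℝ) : ℂ) := integral_complex_ofReal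
    rw [h1]
    exact_mod_cast b.integral_pos.ne'
  · rw [hval] at hξ
    have h1 : ξ ∈ Function.support b := fun h => hξ (by rw [h, Complex.ofReal_zero])
    rw [b.support_eq, hb, mem_ball_iff_norm] at h1
    have h3 : ‖(2 * Real.pi) • ξ - (2 * Real.pi) • c‖ < 1 / 4 := by
      rw [← smul_sub, norm_smul, Real.norm_of_nonneg h2pi.le, ← hr4]
      gcongr
    have h4 := abs_norm_sub_norm_le ((2 * Real.pi) • ξ) ((2 * Real.pi) • c)
    rw [hcn] at h4
    have h5 := abs_le.1 (h4.trans h3.le)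
    constructor <;> linarith [h5.1, h5.2]

/-- On the annulus `2 ^ k 3 / 2 ≤ |x| ≤ 2 ^ k 2` the function `φ_{k + 1}` equals `1` and the other
`φ_j` vanish. -/
theorem Generator.phi_of_mem_annulus (φ : Generator n) (k j : ℕ) (x : Euc n)
    (h1 : 3 / 2 ≤ ‖((2 : ℝ) ^ k)⁻¹ • x‖) (h2 : ‖((2 : ℝ) ^ k)⁻¹ • x‖ ≤ 2) :
    φ.phi j x = if j = k + 1 then 1 else 0 := by
  rw [norm_smul, norm_inv, norm_pow, Real.norm_two] at h1 h2
  have hk : (0 : ℝ) < 2 ^ k := by positivity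
  rw [le_inv_mul_iff₀ hk] at h1
  rw [inv_mul_le_iff₀ hk] at h2
  have hzero : ∀ m : ℕ, m ≤ k → φ.toSchwartz (((2 : ℝ) ^ m)⁻¹ • x) = 0 := by
    intro m hm
    apply φ.eq_zero
    have h3 : (2 : ℝ) ^ m ≤ 2 ^ k := pow_le_pow_right₀ (by norm_num) hm
    rw [norm_smul, norm_inv, norm_pow, Real.norm_two, le_inv_mul_iff₀ (by positivity)]
    linarith
  have hone : ∀ m : ℕ, k + 1 ≤ m → φ.toSchwartz (((2 : ℝ) ^ m)⁻¹ • x) = 1 := by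
    intro m hm
    apply φ.eq_one
    have h3 : (2 : ℝ) ^ (k + 1) ≤ 2 ^ m := pow_le_pow_right₀ (by norm_num) hm
    rw [norm_smul, norm_inv, norm_pow, Real.norm_two, inv_mul_le_iff₀ (by positivity)]
    rw [pow_succ] at h3
    linarith
  rcases j with _ | j
  · rw [if_neg (by omega), Generator.phi_zero_apply]
    simpa using hzero 0 (Nat.zero_le _)
  · have e1 : (2 : ℝ) ^ (-((j : ℤ) + 1) + 1) = ((2 : ℝ) ^ j)⁻¹ := by
      rw [neg_add, neg_add_cancel_right, zpow_neg, zpow_natCast]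
    have e2 : (2 : ℝ) ^ (-((j : ℤ) + 1)) = ((2 : ℝ) ^ (j + 1))⁻¹ := by
      rw [zpow_neg]; norm_cast
    rw [Generator.phi_succ_apply, e1, e2]
    rcases lt_trichotomy j k with h | rfl | h
    · rw [hzero j h.le, hzero (j + 1) h, if_neg (by omega), sub_zero]
    · rw [hzero j le_rfl, hone (j + 1) le_rfl, if_pos rfl, sub_zero]
    · rw [hone j h, hone (j + 1) (by omega), if_neg (by omega), sub_self]

/-- The regular tempered distribution given by a Schwartz function. -/
def regular (h : 𝓢(Euc n, ℂ)) : 𝓢'(Euc n, ℂ) :=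
  SchwartzMap.toTemperedDistributionCLM (Euc n) ℂ volume h

theorem regular_apply (h ψ : 𝓢(Euc n, ℂ)) : regular h ψ = ∫ x, ψ x * h x := by
  exact SchwartzMap.toTemperedDistributionCLM_apply_apply volume h ψ

/-- The pieces of a Schwartz function are given by Fourier multipliers. -/
theorem Generator.piece_regular (φ : Generator n) (h : 𝓢(Euc n, ℂ)) (j : ℕ) (x : Euc n) :
    φ.piece (regular h) j x = (𝓕⁻ (SchwartzMap.smulLeftCLM ℂ
      (dilate (2 * Real.pi) (by positivity) (φ.phi j)) (𝓕 h))) x := by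
  rw [Generator.piece, regular, TemperedDistribution.fourier_toTemperedDistributionCLM_eq]
  change regular (𝓕 h) (φ.testFun j x) = _
  rw [regular_apply, fourierInv_coe, Real.fourierInv_eq']
  refine integral_congr_ae (.of_forall fun ξ => ?_)
  simp only [Generator.testFun_apply,
    SchwartzMap.smulLeftCLM_apply_apply (SchwartzMap.hasTemperateGrowth _), dilate_apply,
    smul_eq_mul, wave]
  rw [real_inner_comm, mul_assoc]
  congr 2
  push_cast
  ring

theorem Generator.piece_regular_dilate (φ : Generator n) (θ : 𝓢(Euc n, ℂ))
    (hθ : SupportedInAnnulus θ) (k j : ℕ)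
    (x : Euc n) :
    φ.piece (regular (dilate ((2 : ℝ) ^ k) (by positivity) (𝓕⁻ θ))) j x =
      if j = k + 1 then (𝓕⁻ θ) ((2 : ℝ) ^ k • x) else 0 := by
  set h := dilate ((2 : ℝ) ^ k) (by positivity) (𝓕⁻ θ) with hh
  have h1 : SchwartzMap.smulLeftCLM ℂ (dilate (2 * Real.pi) (by positivity) (φ.phi j)) (𝓕 h) =
      (if j = k + 1 then (1 : ℂ) else 0) • 𝓕 h := by
    ext ξ
    rw [SchwartzMap.smulLeftCLM_apply_apply (SchwartzMap.hasTemperateGrowth _), dilate_apply,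
      _root_.smul_apply, hh, fourier_dilate _ (by positivity),
      FourierTransform.fourier_fourierInv_eq]
    by_cases h0 : θ (((2 : ℝ) ^ k)⁻¹ • ξ) = 0
    · simp [h0]
    · have h2 := hθ _ h0
      rw [smul_comm] at h2
      rw [φ.phi_of_mem_annulus k j _ h2.1 h2.2]
  rw [φ.piece_regular, h1]
  split_ifs with hj
  · rw [one_smul, FourierTransform.fourierInv_fourier_eq, hh, dilate_apply]
  · rw [zero_smul, FourierTransform.fourierInv_zero, _root_.zero_apply]

/-- The lacunary superposition `∑_{k < N} c_k ψ (2 ^ k ·)`. -/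
def lacunary (ψ : 𝓢(Euc n, ℂ)) (c : ℕ → ℝ) (N : ℕ) : 𝓢(Euc n, ℂ) :=
  ∑ k ∈ Finset.range N, (c k : ℂ) • dilate ((2 : ℝ) ^ k) (by positivity) ψ

theorem lacunary_zero_apply (ψ : 𝓢(Euc n, ℂ)) (c : ℕ → ℝ) (N : ℕ) :
    lacunary ψ c N 0 = ((∑ k ∈ Finset.range N, c k : ℝ) : ℂ) * ψ 0 := by
  rw [lacunary, _root_.sum_apply, Complex.ofReal_sum, Finset.sum_mul]
  refine Finset.sum_congr rfl fun k _ => ?_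
  rw [_root_.smul_apply, dilate_apply, smul_zero, smul_eq_mul]

/-- The frequency pieces of a lacunary sum are its summands. -/
theorem Generator.piece_lacunary (φ : Generator n) (θ : 𝓢(Euc n, ℂ))
    (hθ : SupportedInAnnulus θ) (c : ℕ → ℝ)
    (N j : ℕ) (x : Euc n) :
    φ.piece (regular (lacunary (𝓕⁻ θ) c N)) j x =
      ∑ k ∈ Finset.range N, if j = k + 1 then (c k : ℂ) * (𝓕⁻ θ) ((2 : ℝ) ^ k • x) else 0 := by
  have h1 : φ.piece (regular (lacunary (𝓕⁻ θ) c N)) j x = ∑ k ∈ Finset.range N, (c k : ℂ) *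
      φ.piece (regular (dilate ((2 : ℝ) ^ k) (by positivity) (𝓕⁻ θ))) j x := by
    simp only [φ.piece_eq_bandPart, bandPart_eq, regular_apply, lacunary]
    simp only [_root_.sum_apply, _root_.smul_apply, Finset.mul_sum, smul_eq_mul]
    rw [integral_finsetSum]
    · refine Finset.sum_congr rfl fun k _ => ?_
      rw [← integral_const_mul]
      refine integral_congr_ae (.of_forall fun y => ?_)
      simp only
      ring
    · intro k _
      exact (SchwartzMap.integrable _).mul_bdd
        ((dilate ((2 : ℝ) ^ k) (by positivity) (𝓕⁻ θ)).continuous.const_smul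
          (c k : ℂ)).aestronglyMeasurable
        (.of_forall fun y => (norm_mul_le _ _).trans
          (mul_le_mul_of_nonneg_left (SchwartzMap.norm_le_seminorm ℂ _ y) (norm_nonneg _)))
  rw [h1]
  refine Finset.sum_congr rfl fun k _ => ?_
  rw [φ.piece_regular_dilate θ hθ]
  split_ifs <;> simp

/-- If a Schwartz function represents an element of `L_∞`, its values are bounded by the norm. -/
theorem enorm_apply_le_of_isRegular (h : 𝓢(Euc n, ℂ)) (g : Lp ℂ ∞ (volume : Measure (Euc n)))
    (hg : IsRegular (regular h) g) (x : Euc n) : ‖h x‖ₑ ≤ ‖g‖ₑ := by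
  have h1 : h.toLp ∞ volume = g := by
    have hker := MeasureTheory.Lp.ker_toTemperedDistributionCLM_eq_bot (F := ℂ)
      (μ := (volume : Measure (Euc n))) (p := ∞)
    refine LinearMap.ker_eq_bot.1 hker ?_
    ext ψ
    exact ((MeasureTheory.Lp.toTemperedDistribution_apply (h.toLp ∞ volume) ψ).trans
      (integral_congr_ae (by
        filter_upwards [h.coeFn_toLp ∞ volume] with y hy
        rw [hy, smul_eq_mul]))).trans ((regular_apply h ψ).symm.trans ((hg ψ).trans
        (MeasureTheory.Lp.toTemperedDistribution_apply g ψ).symm))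
  by_contra! hlt
  have hopen : IsOpen {y | ‖g‖ₑ < ‖h y‖ₑ} := isOpen_lt continuous_const h.continuous.enorm
  have hnull : volume {y | ‖g‖ₑ < ‖h y‖ₑ} = 0 := by
    have h2 := enorm_ae_le_eLpNormEssSup (h.toLp ∞ volume) volume
    have h3 := h.coeFn_toLp ∞ volume
    rw [measure_eq_zero_iff_ae_notMem]
    filter_upwards [h2, h3] with y hy hy'
    rw [not_lt, ← hy', ← h1, Lp.enorm_def, eLpNorm_exponent_top]
    exact hy
  rw [hopen.measure_eq_zero_iff volume] at hnull
  exact (Set.eq_empty_iff_forall_notMem.1 hnull x) hlt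

theorem EmbedsC.embedsLinfty {N : 𝓢'(Euc n, ℂ) → ℝ≥0∞} (h : EmbedsC N) : EmbedsLinfty N := by
  obtain ⟨C, hC⟩ := h
  refine ⟨C, fun f hf => ?_⟩
  obtain ⟨g, hg, hgn⟩ := hC f hf
  have hmem : MemLp g ∞ (volume : Measure (Euc n)) :=
    memLp_top_of_bound g.continuous.aestronglyMeasurable ‖g‖ (.of_forall g.norm_coe_le_norm)
  refine ⟨hmem.toLp g, fun ψ => ?_, le_trans ?_ hgn⟩
  · rw [hg ψ]
    refine integral_congr_ae ?_
    filter_upwards [hmem.coeFn_toLp] with x hx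
    rw [hx]
  · rw [Lp.enorm_toLp, eLpNorm_exponent_top]
    refine essSup_le_of_ae_le _ (.of_forall fun x => ?_)
    rw [← ofReal_norm]
    change ‖g x‖ₑ ≤ _
    rw [← ofReal_norm]
    exact ENNReal.ofReal_le_ofReal (g.norm_coe_le_norm x)

/-! ### Necessary conditions for the embeddings -/

/-- A Schwartz function is dominated by every power `|z| ^ (-a)`, `a ≥ 0`. At `z = 0` the right-hand
side is infinite if `a > 0`. -/
theorem exists_enorm_le_rpow (θ : 𝓢(Euc n, ℂ)) {a : ℝ} (ha : 0 ≤ a) :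
    ∃ D : ℝ≥0, ∀ z, ‖θ z‖ₑ ≤ D * ‖z‖ₑ ^ (-a) := by
  obtain ⟨m, hm⟩ := exists_nat_ge a
  obtain ⟨D, hD⟩ := exists_norm_le_one_add_norm_pow θ m
  -- the constant must not vanish, since `0 * ∞ = 0` at the origin
  refine ⟨D + 1, fun z => ?_⟩
  rcases eq_or_ne z 0 with rfl | hz
  · rcases ha.eq_or_lt with rfl | ha
    · have := hD 0
      simp only [norm_zero, add_zero, one_pow, inv_one, mul_one] at this
      rw [neg_zero, ENNReal.rpow_zero, mul_one, ← ofReal_norm, ← ENNReal.ofReal_coe_nnreal]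
      refine ENNReal.ofReal_le_ofReal (this.trans ?_)
      push_cast
      linarith
    · rw [enorm_zero, ENNReal.zero_rpow_of_neg (by linarith), ENNReal.mul_top (by simp)]
      exact le_top
  · have hz' : 0 < ‖z‖ := norm_pos_iff.2 hz
    rw [← ofReal_norm, ← ofReal_norm, ENNReal.ofReal_rpow_of_pos hz', ← ENNReal.ofReal_coe_nnreal,
      ← ENNReal.ofReal_mul (by positivity)]
    refine ENNReal.ofReal_le_ofReal ((hD z).trans ?_)
    push_cast
    refine mul_le_mul (by linarith) ?_ (by positivity) (by positivity)
    rw [Real.rpow_neg hz'.le]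
    refine inv_anti₀ (by positivity) ?_
    rw [← Real.rpow_natCast]
    exact (Real.rpow_le_rpow hz'.le (by linarith) ha).trans
      (Real.rpow_le_rpow_of_exponent_le (by linarith) hm)

/-- The lacunary sum `∑_{1 ≤ j ≤ N} 2 ^ (j (r - s)) w_j ψ (2 ^ (j - 1) ·)`. The value `w 0` is not
used. -/
def lacunarySum (ψ : 𝓢(Euc n, ℂ)) (r s : ℝ) (w : ℕ → ℝ) (N : ℕ) : 𝓢(Euc n, ℂ) :=
  lacunary ψ (fun k => (2 : ℝ) ^ (((k + 1 : ℕ) : ℝ) * (r - s)) * w (k + 1)) N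

/-- For the lacunary sums, `2 ^ (j s) |f_j x|` is at most `C_a w_j 2 ^ (j (r - a)) |x| ^ (-a)` for
every `a ≥ 0`. -/
theorem Generator.exists_scaled_lacunarySum_le (φ : Generator n) (θ : 𝓢(Euc n, ℂ))
    (hθ : SupportedInAnnulus θ) (r s : ℝ) {a : ℝ}
    (ha : 0 ≤ a) :
    ∃ C : ℝ≥0, ∀ (w : ℕ → ℝ), (∀ j, 0 ≤ w j) → ∀ (N j : ℕ) (x : Euc n),
      φ.scaled s (regular (lacunarySum (𝓕⁻ θ) r s w N)) j x ≤
        C * ENNReal.ofReal (if j ≤ N then w j else 0) *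
          (ENNReal.ofReal ((2 : ℝ) ^ (j * (r - a))) * ‖x‖ₑ ^ (-a)) := by
  obtain ⟨D, hD⟩ := exists_enorm_le_rpow (𝓕⁻ θ) ha
  obtain ⟨E, hE⟩ : ∃ E : ℝ≥0, (E : ℝ≥0∞) = ENNReal.ofReal ((2 : ℝ) ^ a) := ⟨_, rfl⟩
  refine ⟨D * E, fun w hw N j x => ?_⟩
  rw [Generator.scaled, lacunarySum, φ.piece_lacunary θ hθ]
  rcases j with _ | k
  · simp
  have hsum : ∀ F : ℕ → ℂ, (∑ i ∈ Finset.range N, if k + 1 = i + 1 then F i else 0) =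
      if k < N then F k else 0 := by
    intro F
    simp only [Nat.add_right_cancel_iff, Finset.sum_ite_eq, Finset.mem_range]
  rw [hsum]
  by_cases hk : k < N
  · rw [if_pos hk, if_pos (Nat.succ_le_of_lt hk), enorm_mul]
    have h1 := hD ((2 : ℝ) ^ k • x)
    rw [enorm_smul, ENNReal.mul_rpow_of_ne_top (by simp) (by simp),
      Real.enorm_of_nonneg (by positivity), ENNReal.ofReal_rpow_of_pos (by positivity)] at h1
    refine (mul_le_mul_right (mul_le_mul_right h1 _) _).trans (le_of_eq ?_)
    have hc : ‖(((2 : ℝ) ^ (((k + 1 : ℕ) : ℝ) * (r - s)) * w (k + 1) : ℝ) : ℂ)‖ₑ =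
        ENNReal.ofReal ((2 : ℝ) ^ (((k + 1 : ℕ) : ℝ) * (r - s))) * ENNReal.ofReal (w (k + 1)) := by
      rw [← ofReal_norm, Complex.norm_real, Real.norm_of_nonneg (mul_nonneg (by positivity) (hw _)),
        ENNReal.ofReal_mul (by positivity)]
    have he : ENNReal.ofReal ((2 : ℝ) ^ (((k + 1 : ℕ) : ℝ) * s)) *
        ENNReal.ofReal ((2 : ℝ) ^ (((k + 1 : ℕ) : ℝ) * (r - s))) *
        ENNReal.ofReal (((2 : ℝ) ^ k) ^ (-a)) = ENNReal.ofReal ((2 : ℝ) ^ a) *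
        ENNReal.ofReal ((2 : ℝ) ^ (((k + 1 : ℕ) : ℝ) * (r - a))) := by
      rw [← Real.rpow_natCast 2 k, ← Real.rpow_mul two_pos.le, ← ENNReal.ofReal_mul (by positivity),
        ← ENNReal.ofReal_mul (by positivity), ← ENNReal.ofReal_mul (by positivity),
        ← Real.rpow_add two_pos, ← Real.rpow_add two_pos, ← Real.rpow_add two_pos]
      congr 2
      push_cast
      ring
    rw [hc, ENNReal.coe_mul, hE]
    calc _ = D * ENNReal.ofReal (w (k + 1)) * (ENNReal.ofReal ((2 : ℝ) ^ (((k + 1 : ℕ) : ℝ) * s)) *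
        ENNReal.ofReal ((2 : ℝ) ^ (((k + 1 : ℕ) : ℝ) * (r - s))) *
        ENNReal.ofReal (((2 : ℝ) ^ k) ^ (-a))) * ‖x‖ₑ ^ (-a) := by ring
      _ = _ := by rw [he]; ring
  · simp [hk]

theorem exists_norm_eq_two_rpow {x : Euc n} (hx : x ≠ 0) :
    ∃ (k : ℤ) (t : ℝ), 0 ≤ t ∧ t ≤ 1 ∧ ‖x‖ = (2 : ℝ) ^ (t - k) := by
  have hx' : 0 < ‖x‖ := norm_pos_iff.2 hx
  refine ⟨⌈-Real.logb 2 ‖x‖⌉, ⌈-Real.logb 2 ‖x‖⌉ + Real.logb 2 ‖x‖, ?_, ?_, ?_⟩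
  · linarith [Int.le_ceil (-Real.logb 2 ‖x‖)]
  · linarith [Int.ceil_lt_add_one (-Real.logb 2 ‖x‖)]
  · rw [add_sub_cancel_left, Real.rpow_logb two_pos (by norm_num) hx']

theorem rpow_mul_norm_rpow {x : Euc n} {t k : ℝ} (ht : ‖x‖ = (2 : ℝ) ^ (t - k)) (b a : ℝ) :
    ENNReal.ofReal ((2 : ℝ) ^ b) * ‖x‖ₑ ^ (-a) = ENNReal.ofReal ((2 : ℝ) ^ (b - (t - k) * a)) := by
  rw [← ofReal_norm, ht, ENNReal.ofReal_rpow_of_pos (by positivity),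
    ← ENNReal.ofReal_mul (by positivity), ← Real.rpow_mul two_pos.le, ← Real.rpow_add two_pos]
  congr 2
  ring

/-- The frequency pieces of the lacunary sums decay geometrically away from the scale of `x`, so
that their `ℓ_q` norm is controlled by `|x| ^ (-r)`, uniformly in the number of summands. -/
theorem Generator.exists_lqSeq_scaled_lacunarySum_le (φ : Generator n) (θ : 𝓢(Euc n, ℂ))
    (hθ : SupportedInAnnulus θ) {r : ℝ}
    (hr : 0 < r) (s : ℝ) {q : ℝ≥0∞} (hq : 0 < q) :
    ∃ C : ℝ≥0, ∀ (N : ℕ) (x : Euc n),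
      lqSeq q (fun j => φ.scaled s (regular (lacunarySum (𝓕⁻ θ) r s (fun _ => 1) N)) j x) ≤
        C * ‖x‖ₑ ^ (-r) := by
  -- `a = 0` is used for `2 ^ j |x| ≲ 1`, and `a = 2 r` otherwise
  obtain ⟨C₁, h₁⟩ := φ.exists_scaled_lacunarySum_le θ hθ r s le_rfl
  obtain ⟨C₂, h₂⟩ := φ.exists_scaled_lacunarySum_le θ hθ r s (a := 2 * r) (by positivity)
  obtain ⟨K, hK⟩ := exists_lqSeq_geometric_le hq hr
  obtain ⟨E, hE⟩ : ∃ E : ℝ≥0, (E : ℝ≥0∞) = ENNReal.ofReal ((2 : ℝ) ^ r) := ⟨_, rfl⟩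
  have hv : ∀ N j : ℕ, ENNReal.ofReal (if j ≤ N then (1 : ℝ) else 0) ≤ 1 := fun N j =>
    ENNReal.ofReal_le_one.2 (by split_ifs <;> norm_num)
  refine ⟨(C₁ + C₂) * E * K + 1, fun N x => ?_⟩
  rcases eq_or_ne x 0 with rfl | hx
  · rw [enorm_zero, ENNReal.zero_rpow_of_neg (by linarith), ENNReal.mul_top (by simp)]
    exact le_top
  obtain ⟨k, t, ht0, ht1, hkt⟩ := exists_norm_eq_two_rpow hx
  have key : ∀ j : ℕ, φ.scaled s (regular (lacunarySum (𝓕⁻ θ) r s (fun _ => 1) N)) j x ≤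
      ((C₁ + C₂) * E * ‖x‖ₑ ^ (-r)) * ENNReal.ofReal ((2 : ℝ) ^ (-r * |((j : ℤ) - k : ℤ)|)) := by
    intro j
    have e1 := rpow_mul_norm_rpow hkt (-r * |((j : ℤ) - k : ℤ)|) r
    rw [mul_assoc, mul_comm (‖x‖ₑ ^ (-r)), e1, mul_assoc, hE, ← ENNReal.ofReal_mul (by positivity),
      ← Real.rpow_add two_pos]
    rcases le_total (j : ℤ) k with hjk | hjk
    · have hjk' : (j : ℝ) ≤ k := by exact_mod_cast hjk
      refine (h₁ _ (fun _ => zero_le_one) N j x).trans (mul_le_mul' ?_ ?_)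
      · exact (mul_le_mul_right (hv N j) _).trans (by rw [mul_one]; exact le_self_add)
      · rw [rpow_mul_norm_rpow hkt]
        refine ENNReal.ofReal_le_ofReal (Real.rpow_le_rpow_of_exponent_le one_le_two ?_)
        rw [abs_of_nonpos (by omega)]
        push_cast
        nlinarith
    · have hjk' : (k : ℝ) ≤ j := by exact_mod_cast hjk
      refine (h₂ _ (fun _ => zero_le_one) N j x).trans (mul_le_mul' ?_ ?_)
      · exact (mul_le_mul_right (hv N j) _).trans (by rw [mul_one]; exact le_add_self)
      · rw [rpow_mul_norm_rpow hkt]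
        refine ENNReal.ofReal_le_ofReal (Real.rpow_le_rpow_of_exponent_le one_le_two ?_)
        rw [abs_of_nonneg (by omega)]
        push_cast
        nlinarith
  refine (lqSeq_mono key).trans ?_
  rw [lqSeq_const_mul hq]
  refine (mul_le_mul_right (hK k) _).trans ?_
  push_cast
  calc (C₁ + C₂) * E * ‖x‖ₑ ^ (-r) * K = (C₁ + C₂) * E * K * ‖x‖ₑ ^ (-r) := by ring
    _ ≤ _ := mul_le_mul_left le_self_add _

theorem morreyNorm_const_mul (ϱ : ℝ) {p : ℝ} (hp : 0 < p) {c : ℝ≥0∞} (hc : c ≠ ∞)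
    (h : Euc n → ℝ≥0∞) : morreyNorm ϱ p (fun x => c * h x) = c * morreyNorm ϱ p h := by
  unfold morreyNorm
  simp_rw [lpOn_const_mul hp _ hc, mul_left_comm _ c, ENNReal.mul_iSup]

/-- The quasi-norms in `Λ_ϱ F^s_{p,q}` of the unweighted lacunary sums are bounded. -/
theorem exists_lowerF_lacunarySum_le (hn : 1 ≤ n) (φ : Generator n) (θ : 𝓢(Euc n, ℂ))
    (hθ : SupportedInAnnulus θ) {p ϱ : ℝ}
    (hp : 0 < p) (hϱ : -(n : ℝ) < ϱ) (hϱ0 : ϱ < 0) (s : ℝ) {q : ℝ≥0∞} (hq : 0 < q) :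
    ∃ C : ℝ≥0, ∀ N : ℕ,
      lowerF φ ϱ s p q (regular (lacunarySum (𝓕⁻ θ) (|ϱ| / p) s (fun _ => 1) N)) ≤ C := by
  obtain ⟨C, hC⟩ := φ.exists_lqSeq_scaled_lacunarySum_le θ hθ (r := |ϱ| / p)
    (div_pos (abs_pos.2 hϱ0.ne) hp) s hq
  have hfin := morreyNorm_rpow_lt_top hn hp hϱ hϱ0
  refine ⟨C * (morreyNorm ϱ p (fun x : Euc n => ‖x‖ₑ ^ (-(|ϱ| / p)))).toNNReal, fun N => ?_⟩
  rw [ENNReal.coe_mul, ENNReal.coe_toNNReal hfin.ne]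
  refine (morreyNorm_mono hp (hC N)).trans ?_
  rw [morreyNorm_const_mul _ hp ENNReal.coe_ne_top]

theorem upperF_le_lowerF (φ : Generator n) (ϱ s : ℝ) {p : ℝ} (hp : 0 < p) (q : ℝ≥0∞)
    (f : 𝓢'(Euc n, ℂ)) : upperF φ ϱ s p q f ≤ lowerF φ ϱ s p q f := by
  refine iSup₂_mono fun J M => mul_le_mul_right (lpOn_mono hp _ fun x => lqSeq_mono fun j => ?_) _
  split_ifs
  · exact le_rfl
  · exact zero_le

/-- The quasi-norms in `Λ^ϱ B^s_{p,q}` of the unweighted lacunary sums are bounded: for a cube of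
side length `2 ^ (-J)` the pieces with `j ≥ J` decay geometrically in `j - J`. -/
theorem exists_upperB_lacunarySum_le (hn : 1 ≤ n) (φ : Generator n) (θ : 𝓢(Euc n, ℂ))
    (hθ : SupportedInAnnulus θ) {p ϱ : ℝ}
    (hp : 0 < p) (hϱ : -(n : ℝ) < ϱ) (hϱ0 : ϱ < 0) (s : ℝ) {q : ℝ≥0∞} (hq : 0 < q) :
    ∃ C : ℝ≥0, ∀ N : ℕ,
      upperB φ ϱ s p q (regular (lacunarySum (𝓕⁻ θ) (|ϱ| / p) s (fun _ => 1) N)) ≤ C := by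
  -- a power slightly stronger than the critical one gives the geometric decay, and `a p < n` still
  -- makes it locally integrable
  obtain ⟨δ, hδ, hδn⟩ : ∃ δ : ℝ, 0 < δ ∧ (|ϱ| / p + δ) * p < n := by
    refine ⟨(n + ϱ) / (2 * p), div_pos (by linarith) (by positivity), ?_⟩
    rw [abs_of_neg hϱ0]
    field_simp
    linarith
  have ha : 0 ≤ |ϱ| / p + δ := by positivity
  obtain ⟨C₁, h₁⟩ := φ.exists_scaled_lacunarySum_le θ hθ (|ϱ| / p) s ha
  obtain ⟨C₂, h₂⟩ := lpOn_dyadicCube_rpow_le hn hp ha hδn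
  obtain ⟨K, hK⟩ := exists_lqSeq_geometric_le hq hδ
  refine ⟨C₁ * C₂ * K, fun N => iSup₂_le fun J M => ?_⟩
  rw [← lqSeq_const_mul hq]
  push_cast
  refine le_trans ?_ (mul_le_mul_right (hK J) _)
  rw [← lqSeq_const_mul hq]
  refine lqSeq_mono fun j => ?_
  split_ifs with hj
  swap
  · rw [mul_zero]
    exact zero_le
  have hle : ∀ x, φ.scaled s (regular (lacunarySum (𝓕⁻ θ) (|ϱ| / p) s (fun _ => 1) N)) j x ≤
      C₁ * ENNReal.ofReal ((2 : ℝ) ^ (j * (-δ))) * ‖x‖ₑ ^ (-(|ϱ| / p + δ)) := by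
    intro x
    refine (h₁ _ (fun _ => zero_le_one) N j x).trans ?_
    rw [← mul_assoc, sub_add_cancel_left]
    refine mul_le_mul_left (mul_le_mul_left ?_ _) _
    refine (mul_le_mul_right (ENNReal.ofReal_le_one.2 ?_) _).trans_eq (mul_one _)
    split_ifs <;> norm_num
  refine (mul_le_mul_right ((lpOn_mono hp _ hle).trans_eq (lpOn_const_mul hp _
    (ENNReal.mul_ne_top ENNReal.coe_ne_top ENNReal.ofReal_ne_top) _)) _).trans ?_
  refine (mul_le_mul_right (mul_le_mul_right (h₂ J M) _) _).trans_eq ?_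
  have hJj : J ≤ j := (Int.self_le_toNat J).trans (by exact_mod_cast hj)
  have he : weight n ϱ p J * (ENNReal.ofReal ((2 : ℝ) ^ (j * (-δ))) *
      ENNReal.ofReal ((2 : ℝ) ^ (-(J : ℝ) * (n / p - (|ϱ| / p + δ))))) =
      ENNReal.ofReal ((2 : ℝ) ^ (-δ * |((j : ℤ) - J : ℤ)|)) := by
    rw [weight, ← ENNReal.ofReal_mul (by positivity), ← ENNReal.ofReal_mul (by positivity),
      ← Real.rpow_add two_pos, ← Real.rpow_add two_pos, abs_of_neg hϱ0,
      abs_of_nonneg (sub_nonneg.2 hJj)]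
    congr 2
    push_cast
    field_simp
    ring
  rw [← he]
  ring

/-- In the Morrey norm the pieces of a lacunary sum are bounded by their weights. -/
theorem exists_morreyNorm_scaled_lacunarySum_le (hn : 1 ≤ n) (φ : Generator n)
    (θ : 𝓢(Euc n, ℂ))
    (hθ : SupportedInAnnulus θ) {p ϱ : ℝ}
    (hp : 0 < p) (hϱ : -(n : ℝ) < ϱ) (hϱ0 : ϱ < 0) (s : ℝ) :
    ∃ C : ℝ≥0, ∀ (w : ℕ → ℝ), (∀ j, 0 ≤ w j) → ∀ N j : ℕ,
      morreyNorm ϱ p (φ.scaled s (regular (lacunarySum (𝓕⁻ θ) (|ϱ| / p) s w N)) j) ≤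
        C * ENNReal.ofReal (if j ≤ N then w j else 0) := by
  obtain ⟨C, hC⟩ := φ.exists_scaled_lacunarySum_le θ hθ (|ϱ| / p) s (a := |ϱ| / p)
    (by positivity)
  have hfin := morreyNorm_rpow_lt_top hn hp hϱ hϱ0
  refine ⟨C * (morreyNorm ϱ p (fun x : Euc n => ‖x‖ₑ ^ (-(|ϱ| / p)))).toNNReal,
    fun w hw N j => (morreyNorm_mono hp (hC w hw N j)).trans_eq ?_⟩
  simp only [sub_self, mul_zero, Real.rpow_zero, ENNReal.ofReal_one, one_mul]
  rw [morreyNorm_const_mul _ hp (ENNReal.mul_ne_top ENNReal.coe_ne_top ENNReal.ofReal_ne_top),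
    ENNReal.coe_mul, ENNReal.coe_toNNReal hfin.ne, mul_right_comm]

/-- An embedding into `L_∞` bounds the coefficient sum of a lacunary sum, which is up to a constant
its value at the origin, by its quasi-norm. -/
theorem EmbedsLinfty.exists_sum_le {Nrm : 𝓢'(Euc n, ℂ) → ℝ≥0∞} (h : EmbedsLinfty Nrm)
    (θ : 𝓢(Euc n, ℂ)) (hθ0 : (∫ ξ, θ ξ) ≠ 0) (r s : ℝ) :
    ∃ A : ℝ, ∀ (w : ℕ → ℝ) (N : ℕ) (B : ℝ≥0),
      Nrm (regular (lacunarySum (𝓕⁻ θ) r s w N)) ≤ B →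
        ∑ k ∈ Finset.range N, (2 : ℝ) ^ (((k + 1 : ℕ) : ℝ) * (r - s)) * w (k + 1) ≤ A * B := by
  obtain ⟨C, hC⟩ := h
  have hψ : (𝓕⁻ θ) 0 = ∫ ξ, θ ξ := by
    rw [fourierInv_coe, Real.fourierInv_eq']
    simp
  have hpos : 0 < ‖∫ ξ, θ ξ‖ := norm_pos_iff.2 hθ0
  refine ⟨C * ‖∫ ξ, θ ξ‖⁻¹, fun w N B hB => ?_⟩
  obtain ⟨g, hg, hgC⟩ := hC _ (hB.trans_lt ENNReal.coe_lt_top)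
  have h1 := (enorm_apply_le_of_isRegular _ g hg 0).trans (hgC.trans (mul_le_mul_right hB _))
  rw [lacunarySum, lacunary_zero_apply, hψ, ← ENNReal.coe_mul, enorm_le_coe, ← NNReal.coe_le_coe,
    coe_nnnorm, norm_mul, Complex.norm_real, NNReal.coe_mul] at h1
  rw [mul_right_comm, le_mul_inv_iff₀ hpos]
  exact (mul_le_mul_of_nonneg_right (Real.le_norm_self _) hpos.le).trans h1

/-- If the unweighted lacunary sums have bounded quasi-norms, their unbounded values at the origin
exclude an embedding with `s ≤ r`. -/
theorem EmbedsLinfty.lt_of_bounded {Nrm : 𝓢'(Euc n, ℂ) → ℝ≥0∞} (h : EmbedsLinfty Nrm)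
    {θ : 𝓢(Euc n, ℂ)} (hθ0 : (∫ ξ, θ ξ) ≠ 0) {r s : ℝ}
    (hN : ∃ C : ℝ≥0, ∀ N : ℕ, Nrm (regular (lacunarySum (𝓕⁻ θ) r s (fun _ => 1) N)) ≤ C) :
    r < s := by
  by_contra! hs
  obtain ⟨C, hC⟩ := hN
  obtain ⟨A, hA⟩ := h.exists_sum_le θ hθ0 r s
  obtain ⟨N, hN⟩ := exists_nat_gt (A * C)
  refine (hN.trans_le ?_).not_ge (hA _ N C (hC N))
  calc (N : ℝ) = ∑ k ∈ Finset.range N, (1 : ℝ) := by simp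
    _ ≤ _ := Finset.sum_le_sum fun k _ => by
      rw [mul_one]
      exact Real.one_le_rpow one_le_two (mul_nonneg (by positivity) (by linarith))

/-- The `ℓ_q` norm of `N + 1` ones. For `q = ∞` the junk value `1 / 0 = 0` of the exponent is the
right one. -/
theorem lqSeq_indicator_le {q : ℝ≥0∞} (hq : 0 < q) (N : ℕ) :
    lqSeq q (fun j => ENNReal.ofReal (if j ≤ N then 1 else 0)) ≤
      ENNReal.ofReal (((N + 1 : ℕ) : ℝ) ^ (1 / q.toReal)) := by
  rw [lqSeq]
  split_ifs with h
  · refine iSup_le fun j => ENNReal.ofReal_le_ofReal ?_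
    rw [h, ENNReal.toReal_top, div_zero, Real.rpow_zero]
    split_ifs <;> norm_num
  · have hq' : 0 < q.toReal := ENNReal.toReal_pos hq.ne' h
    rw [← ENNReal.ofReal_rpow_of_pos (by positivity), ENNReal.ofReal_natCast]
    gcongr
    rw [tsum_eq_sum (s := Finset.range (N + 1))]
    · refine (Finset.sum_le_card_nsmul _ _ 1 fun j _ => ?_).trans (by simp)
      refine ENNReal.rpow_le_one (ENNReal.ofReal_le_one.2 ?_) hq'.le
      split_ifs <;> norm_num
    · intro j hj
      rw [if_neg (by simpa [Nat.lt_succ_iff] using hj), ENNReal.ofReal_zero,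
        ENNReal.zero_rpow_of_pos hq']

theorem not_linear_growth {A α : ℝ} (hα : α < 1)
    (h : ∀ N : ℕ, (N : ℝ) ≤ A * ((N + 1 : ℕ) : ℝ) ^ α) : False := by
  have h1 : Tendsto (fun N : ℕ => ((N + 1 : ℕ) : ℝ) ^ (1 - α)) atTop atTop :=
    (tendsto_rpow_atTop (by linarith)).comp
      (tendsto_natCast_atTop_atTop.comp (tendsto_add_atTop_nat 1))
  obtain ⟨N, hN, hN1⟩ := ((h1.eventually_gt_atTop (2 * A)).and (eventually_ge_atTop 1)).exists
  have hpos : (0 : ℝ) < ((N + 1 : ℕ) : ℝ) := by positivity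
  have h2 := mul_lt_mul_of_pos_right hN (Real.rpow_pos_of_pos hpos α)
  rw [← Real.rpow_add hpos, sub_add_cancel, Real.rpow_one] at h2
  have h3 : (1 : ℝ) ≤ N := by exact_mod_cast hN1
  have h4 := h N
  push_cast at h2 h4
  linarith

/-- The necessary condition for `Λ_ϱ B^s_{p,q}`. Equal weights exclude `q > 1` for `s = |ϱ| / p`,
and single summands exclude `s < |ϱ| / p`. -/
theorem EmbedsLinfty.of_lowerB (hn : 1 ≤ n) (φ : Generator n) {s p ϱ : ℝ} {q : ℝ≥0∞}
    (hp : 0 < p) (hq : 0 < q) (hϱ : -(n : ℝ) < ϱ) (hϱ0 : ϱ < 0)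
    (h : EmbedsLinfty (lowerB φ ϱ s p q)) : |ϱ| / p < s ∨ (s = |ϱ| / p ∧ q ≤ 1) := by
  obtain ⟨θ, hθ0, hθ⟩ := exists_annulus_bump hn
  obtain ⟨A, hA⟩ := h.exists_sum_le θ hθ0 (|ϱ| / p) s
  obtain ⟨C, hC⟩ := exists_morreyNorm_scaled_lacunarySum_le hn φ θ hθ hp hϱ hϱ0 s
  have hB : ∀ (w : ℕ → ℝ), (∀ j, 0 ≤ w j) → ∀ N : ℕ,
      lowerB φ ϱ s p q (regular (lacunarySum (𝓕⁻ θ) (|ϱ| / p) s w N)) ≤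
        C * lqSeq q (fun j => ENNReal.ofReal (if j ≤ N then w j else 0)) := fun w hw N =>
    (lqSeq_mono fun j => hC w hw N j).trans_eq (lqSeq_const_mul hq _ _)
  rcases lt_trichotomy (|ϱ| / p) s with hs | hs | hs
  · exact Or.inl hs
  · refine Or.inr ⟨hs.symm, ?_⟩
    by_contra! hq1
    have hα : 1 / q.toReal < 1 := by
      rcases eq_or_ne q ∞ with rfl | hqt
      · simp
      · rw [div_lt_one (ENNReal.toReal_pos hq.ne' hqt)]
        simpa using (ENNReal.toReal_lt_toReal ENNReal.one_ne_top hqt).2 hq1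
    refine not_linear_growth (A := A * C) hα fun N => ?_
    have hle := hA (fun _ => 1) N (C * (((N + 1 : ℕ) : ℝ) ^ (1 / q.toReal)).toNNReal) (by
      refine (hB _ (fun _ => zero_le_one) N).trans ?_
      rw [ENNReal.coe_mul]
      exact mul_le_mul_right (lqSeq_indicator_le hq N) _)
    rw [NNReal.coe_mul, Real.coe_toNNReal _ (by positivity), hs, sub_self] at hle
    simpa [mul_assoc] using hle
  · exfalso
    obtain ⟨K, hK⟩ := exists_lqSeq_geometric_le hq one_pos
    have hgrow : Tendsto (fun m : ℕ => (2 : ℝ) ^ (((m + 1 : ℕ) : ℝ) * (|ϱ| / p - s))) atTop atTop :=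
      (tendsto_rpow_atTop_of_base_gt_one 2 one_lt_two).comp
        ((tendsto_natCast_atTop_atTop.comp (tendsto_add_atTop_nat 1)).atTop_mul_const
          (sub_pos.2 hs))
    obtain ⟨m, hm⟩ := (hgrow.eventually_gt_atTop (A * (C * K : ℝ≥0))).exists
    have hle := hA (fun j => if j = m + 1 then 1 else 0) (m + 1) (C * K) (by
      refine (hB _ (fun j => by split_ifs <;> norm_num) (m + 1)).trans ?_
      rw [ENNReal.coe_mul]
      refine mul_le_mul_right ((lqSeq_mono fun j => ENNReal.ofReal_le_ofReal ?_).trans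
        (hK ((m + 1 : ℕ) : ℤ))) _
      by_cases hj : j = m + 1
      · simp [hj]
      · simp only [hj, if_false, ite_self]
        positivity)
    simp only [Nat.add_right_cancel_iff, mul_ite, mul_one, mul_zero, Finset.sum_ite_eq',
      Finset.mem_range, Nat.lt_succ_self, if_true] at hle
    exact hm.not_ge hle

end MorreySmoothness

end

theorem theorem5p3 (n : ℕ) (hn : 1 ≤ n) (φ : MorreySmoothness.Generator n)
    (s p ϱ : ℝ) (q : ENNReal) (hp : 0 < p) (hq : 0 < q) (hϱ : -(n : ℝ) < ϱ) (hϱ0 : ϱ < 0) :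
    ((MorreySmoothness.EmbedsLinfty (MorreySmoothness.upperB φ ϱ s p q) ↔ |ϱ| / p < s) ∧
      (MorreySmoothness.EmbedsLinfty (MorreySmoothness.upperF φ ϱ s p q) ↔ |ϱ| / p < s) ∧
      (MorreySmoothness.EmbedsLinfty (MorreySmoothness.lowerB φ ϱ s p q) ↔
        |ϱ| / p < s ∨ (s = |ϱ| / p ∧ q ≤ 1)) ∧
      (MorreySmoothness.EmbedsLinfty (MorreySmoothness.lowerF φ ϱ s p q) ↔ |ϱ| / p < s)) ∧
    ((MorreySmoothness.EmbedsC (MorreySmoothness.upperB φ ϱ s p q) ↔ |ϱ| / p < s) ∧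
      (MorreySmoothness.EmbedsC (MorreySmoothness.upperF φ ϱ s p q) ↔ |ϱ| / p < s) ∧
      (MorreySmoothness.EmbedsC (MorreySmoothness.lowerB φ ϱ s p q) ↔
        |ϱ| / p < s ∨ (s = |ϱ| / p ∧ q ≤ 1)) ∧
      (MorreySmoothness.EmbedsC (MorreySmoothness.lowerF φ ϱ s p q) ↔ |ϱ| / p < s)) := by
  have hupperB : MorreySmoothness.EmbedsLinfty (MorreySmoothness.upperB φ ϱ s p q) →
      |ϱ| / p < s := by
    intro h
    obtain ⟨θ, hθ0, hθ⟩ := MorreySmoothness.exists_annulus_bump hn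
    exact h.lt_of_bounded hθ0
      (MorreySmoothness.exists_upperB_lacunarySum_le hn φ θ hθ hp hϱ hϱ0 s hq)
  have hlowerF : MorreySmoothness.EmbedsLinfty (MorreySmoothness.lowerF φ ϱ s p q) →
      |ϱ| / p < s := by
    intro h
    obtain ⟨θ, hθ0, hθ⟩ := MorreySmoothness.exists_annulus_bump hn
    exact h.lt_of_bounded hθ0
      (MorreySmoothness.exists_lowerF_lacunarySum_le hn φ θ hθ hp hϱ hϱ0 s hq)
  have hupperF : MorreySmoothness.EmbedsLinfty (MorreySmoothness.upperF φ ϱ s p q) →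
      |ϱ| / p < s := by
    intro h
    obtain ⟨θ, hθ0, hθ⟩ := MorreySmoothness.exists_annulus_bump hn
    obtain ⟨C, hC⟩ := MorreySmoothness.exists_lowerF_lacunarySum_le hn φ θ hθ hp hϱ hϱ0 s hq
    exact h.lt_of_bounded hθ0
      ⟨C, fun N => (MorreySmoothness.upperF_le_lowerF φ ϱ s hp q _).trans (hC N)⟩
  have hlowerB : MorreySmoothness.EmbedsLinfty (MorreySmoothness.lowerB φ ϱ s p q) →
      |ϱ| / p < s ∨ (s = |ϱ| / p ∧ q ≤ 1) :=
    MorreySmoothness.EmbedsLinfty.of_lowerB hn φ hp hq hϱ hϱ0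
  have cupperB : |ϱ| / p < s → MorreySmoothness.EmbedsC (MorreySmoothness.upperB φ ϱ s p q) :=
    fun hs => MorreySmoothness.embedsC_of_lt φ hp hϱ0 hs _
      (MorreySmoothness.levelNorm_le_upperB φ ϱ s p hq)
  have cupperF : |ϱ| / p < s → MorreySmoothness.EmbedsC (MorreySmoothness.upperF φ ϱ s p q) :=
    fun hs => MorreySmoothness.embedsC_of_lt φ hp hϱ0 hs _
      (MorreySmoothness.levelNorm_le_upperF φ ϱ s hp hq)
  have clowerF : |ϱ| / p < s → MorreySmoothness.EmbedsC (MorreySmoothness.lowerF φ ϱ s p q) :=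
    fun hs => MorreySmoothness.embedsC_of_lt φ hp hϱ0 hs _
      (MorreySmoothness.levelNorm_le_lowerF φ ϱ s hp hq)
  have clowerB : |ϱ| / p < s ∨ (s = |ϱ| / p ∧ q ≤ 1) →
      MorreySmoothness.EmbedsC (MorreySmoothness.lowerB φ ϱ s p q) := by
    rintro (hs | ⟨rfl, hq1⟩)
    · exact MorreySmoothness.embedsC_of_lt φ hp hϱ0 hs _
        (MorreySmoothness.levelNorm_le_lowerB φ ϱ s p hq)
    · exact MorreySmoothness.embedsC_lowerB_of_le_one φ hp hϱ0 hq hq1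
  exact ⟨⟨⟨hupperB, fun h => (cupperB h).embedsLinfty⟩,
      ⟨hupperF, fun h => (cupperF h).embedsLinfty⟩,
      ⟨hlowerB, fun h => (clowerB h).embedsLinfty⟩, ⟨hlowerF, fun h => (clowerF h).embedsLinfty⟩⟩,
    ⟨⟨fun h => hupperB h.embedsLinfty, cupperB⟩, ⟨fun h => hupperF h.embedsLinfty, cupperF⟩,
      ⟨fun h => hlowerB h.embedsLinfty, clowerB⟩, ⟨fun h => hlowerF h.embedsLinfty, clowerF⟩⟩⟩
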